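/- Let $d\ge 0$ be an integer and $x_0\in\mathbb R^d$. Let $D=(D^{ij})$ be a $C^2$ field of real symmetric positive definite $d\times d$ matrices on $\mathbb R^d$, $F=(F^i)$ a $C^1$ vector field on $\mathbb R^d$ and $\Phi$ a continuous real function on $\mathbb R^d$. Repeated indices are summed. Assume the following growth conditions: there are constants $C$ and $0\le\kappa<2$ such that, for all $y\in\mathbb R^d$ and all $i,j$, $$|D^{ij}(y)|\le C(1+|y|)^{\kappa},$$ $$-\log\det D(y),\quad \partial_i\partial_jD^{ij}(y),\quad -\partial_iF^i(y),\quad -\Phi(y)\ \le\ C(1+|y|)^{2-\kappa},$$ $$(y-x_0)^iF^i(y)\le C(1+|y|)^2,\qquad -(y-x_0)^i\,\partial_kD^{ik}(y)\le C(1+|y|)^2 .$$ For $\alpha\in[0,1]$, $\Delta t>0$ and $x\in\mathbb R^d$ put $\Delta x=x-x_0$, $x_\alpha=x_0+\alpha\,\Delta x$, and $$G^\alpha_{\Delta t}(x)=\frac{1}{\sqrt{(4\pi\Delta t)^d\det D(x_\alpha)}}\exp\Big\{-u^i\,\frac{D^{-1}_{ij}(x_\alpha)}{4\Delta t}\,u^j-\alpha\,\partial_iF^i(x_\alpha)\Delta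 t+\alpha^2\,\partial_i\partial_jD^{ij}(x_\alpha)\Delta t-\Phi(x_\alpha)\Delta t\Big\},$$ $$u^i=\Delta x^i-F^i(x_\alpha)\Delta t+2\alpha\,\partial_kD^{ik}(x_\alpha)\Delta t .$$ Then these kernels all have the same moments up to order $\Delta t$. That is, for every $\alpha\in[0,1]$ and all sufficiently small $\Delta t>0$ the integrals $$\langle\Delta x^{i_1}\cdots\Delta x^{i_M}\rangle_\alpha=\int_{\mathbb R^d}\Delta x^{i_1}\cdots\Delta x^{i_M}\,G^\alpha_{\Delta t}(x)\,d^dx\qquad(M\ge 0,\ 1\le i_1,\dots,i_M\le d)$$ converge absolutely, and for all $\alpha,\beta\in[0,1]$, all $M\ge0$ and all $i_1,\dots,i_M$, $$\langle\Delta x^{i_1}\cdots\Delta x^{i_M}\rangle_\alpha-\langle\Delta x^{i_1}\cdots\Delta x^{i_M}\rangle_\beta=o(\Delta t)\qquad(\Delta t\to0^+).$$ In particular every $G^\alpha_{\Delta t}$ is equivalent in this sense to the Gaussian kernel $$\frac{1}{\sqrt{(4\pi\Delta t)^d\det D(x_0)}}\exp\Big\{-(\Delta x^i-F^i(x_0)\Delta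 t)\frac{D^{-1}_{ij}(x_0)}{4\Delta t}(\Delta x^j-F^j(x_0)\Delta t)-\Phi(x_0)\Delta t\Big\}.$$ -/

import Mathlib

open MeasureTheory Filter Topology Asymptotics

noncomputable section

namespace TimeSlice

/-- The coordinate space `ℝ^d`; its `volume` is Lebesgue measure `dμ(x) = dx¹ ⋯ dx^d`. -/
abbrev Coord (d : ℕ) : Type := EuclideanSpace ℝ (Fin d)

variable {d : ℕ}

/-- The partial derivative `∂_k f` of a scalar function. -/
def pd (k : Fin d) (f : Coord d → ℝ) (x : Coord d) : ℝ :=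
  fderiv ℝ f x (EuclideanSpace.single k 1)

/-- The divergence `∂_i F^i` of a vector field. -/
def divF (F : Coord d → Coord d) (x : Coord d) : ℝ :=
  ∑ i, pd i (fun y => F y i) x

/-- The `i`-th component `∂_k D^{ik}` of the divergence of a matrix field. -/
def divD (D : Coord d → Matrix (Fin d) (Fin d) ℝ) (x : Coord d) (i : Fin d) : ℝ :=
  ∑ k, pd k (fun y => D y i k) x

/-- The double divergence `∂_i ∂_j D^{ij}` of a matrix field. -/
def ddivD (D : Coord d → Matrix (Fin d) (Fin d) ℝ) (x : Coord d) : ℝ :=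
  ∑ i, ∑ j, pd i (pd j (fun y => D y i j)) x

/-- The interpolation point `x_α = x₀ + α Δx`, where `Δx = x - x₀`. -/
def interp (α : ℝ) (x₀ x : Coord d) : Coord d := x₀ + α • (x - x₀)

/-- The vector `Δx^i - F^i(x_α) Δt + 2 α ∂_k D^{ik}(x_α) Δt`. -/
def shift (D : Coord d → Matrix (Fin d) (Fin d) ℝ) (F : Coord d → Coord d)
    (α : ℝ) (x₀ : Coord d) (Δt : ℝ) (x : Coord d) (i : Fin d) : ℝ :=
  (x i - x₀ i) - F (interp α x₀ x) i * Δt + 2 * α * divD D (interp α x₀ x) i * Δt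

/-- The density, with respect to Lebesgue measure in `x`, of the time-slice kernel with
interpolation parameter `α`. -/
def kernel (D : Coord d → Matrix (Fin d) (Fin d) ℝ) (F : Coord d → Coord d) (Φ : Coord d → ℝ)
    (α : ℝ) (x₀ : Coord d) (Δt : ℝ) (x : Coord d) : ℝ :=
  1 / Real.sqrt ((4 * Real.pi * Δt) ^ d * (D (interp α x₀ x)).det) *
    Real.exp
      (-(∑ i, ∑ j, shift D F α x₀ Δt x i * ((D (interp α x₀ x))⁻¹ i j / (4 * Δt)) *
            shift D F α x₀ Δt x j)
        - α * divF F (interp α x₀ x) * Δt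
        + α ^ 2 * ddivD D (interp α x₀ x) * Δt
        - Φ (interp α x₀ x) * Δt)

/-- The density of the Gaussian representation: all coefficients are evaluated at `x₀`. -/
def gaussianKernel (D : Coord d → Matrix (Fin d) (Fin d) ℝ) (F : Coord d → Coord d)
    (Φ : Coord d → ℝ) (x₀ : Coord d) (Δt : ℝ) (x : Coord d) : ℝ :=
  1 / Real.sqrt ((4 * Real.pi * Δt) ^ d * (D x₀).det) *
    Real.exp
      (-(∑ i, ∑ j, (x i - x₀ i - F x₀ i * Δt) * ((D x₀)⁻¹ i j / (4 * Δt)) *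
            (x j - x₀ j - F x₀ j * Δt))
        - Φ x₀ * Δt)

/-- The integrand `Δx^{i₁} ⋯ Δx^{i_M} K(x)` of an `M`-th moment of a density `K`. -/
def momentIntegrand (K : Coord d → ℝ) (x₀ : Coord d) {M : ℕ} (i : Fin M → Fin d)
    (x : Coord d) : ℝ :=
  (∏ m, (x (i m) - x₀ (i m))) * K x

/-- The moment `⟨Δx^{i₁} ⋯ Δx^{i_M}⟩` of a density `K`. -/
def moment (K : Coord d → ℝ) (x₀ : Coord d) {M : ℕ} (i : Fin M → Fin d) : ℝ :=
  ∫ x, momentIntegrand K x₀ i x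

/-- All moments of the density `K` exist, as absolutely convergent integrals. -/
def HasMoments (K : Coord d → ℝ) (x₀ : Coord d) : Prop :=
  ∀ (M : ℕ) (i : Fin M → Fin d), Integrable (momentIntegrand K x₀ i)

/-- Two families of densities indexed by the duration `Δt` are equivalent: for small `Δt > 0` all
their moments exist, and corresponding moments of every order `M ≥ 0` agree up to order `Δt`,
that is, up to an error `o(Δt)` as `Δt → 0⁺`. -/
def Equivalent (x₀ : Coord d) (K L : ℝ → Coord d → ℝ) : Prop :=
  (∀ᶠ Δt in 𝓝[>] (0 : ℝ), HasMoments (K Δt) x₀ ∧ HasMoments (L Δt) x₀) ∧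
    ∀ (M : ℕ) (i : Fin M → Fin d),
      (fun Δt : ℝ => moment (K Δt) x₀ i - moment (L Δt) x₀ i) =o[𝓝[>] (0 : ℝ)] fun Δt => Δt

end TimeSlice

end

/-!
# Equivalence of time-slice kernels

In the displacement `h = x - x₀` and with `Δt = ε²`, `h = ε z`, every kernel is, up to the constant
`(4π)^(-d/2)` and the Jacobian, `exp (S (ε z) - ¼ wᵀ T (ε z) w + ε² c (ε z))`, where
`T = D⁻¹` and `S = -½ log det D` are taken at the interpolation point, `w = z - ε b (ε z)`,
`b = F - 2 α div D` and `c = -α div F + α² ∂∂D - Φ`. Only derivatives of `D` up to order two, of `b`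
up to order one and the value of `c` enter the expansion
`g₀ (1 + ε P₁ + ε² P₂ + o(ε²))` around the Gaussian `g₀ = exp (S 0 - ¼ zᵀ A z)`, `A = T 0`, so the
assumed regularity is exactly sufficient (`expands_rescaledExponent`). Dominated convergence turns
this into an expansion of the moments coming from `‖h‖ ≤ δ` (`isLittleO_setIntegral_expansion`).

The moment of order `m` carries a factor `ε^m`, so up to `o(ε²)` the kernel matters only through
the integral of `P₁` and `P₂` (for `m = 0`) and of `z_k P₁` (for `m = 1`). These are found without
computing Gaussian moments. As the Gaussian depends on `D` through the heat equation
`∂g / ∂D^{ij} = ∂_i ∂_j g`, the polynomials `P₁`, `P₂` are sums of Hermite polynomials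
`herm₁, …, herm₄` with coefficients that are polynomials in `z` (`firstPoly`, `secondPoly`), and
integration by parts (`IsStein.apply_mul_raise`) moves the derivatives onto these coefficients. What
is left is the effective drift `2 ∂_k D^{ik} + b^i` and the effective potential
`∂_i ∂_j D^{ij} + ∂_i b^i + c` of the fields as functions of `h`. For the kernel with parameter `α`
the chain rule gives `2 α div D + (F - 2 α div D) = F` and
`α² ∂∂D + (α div F - 2 α² ∂∂D) + (-α div F + α² ∂∂D - Φ) = -Φ`, both independent of `α`. The
Gaussian kernel is the case `α = 0`.

For `‖h‖ ≥ δ` the Cauchy-Schwarz inequality `(u·h)² ≤ (uᵀ D⁻¹ u) (hᵀ D h)` for `u = h - Δt b` and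
the growth conditions bound the exponent by `-(a / Δt) (1 + ‖h‖)^(2 - κ)` for small `Δt` (`hasTailBound_of_growth`), which
gives the existence of all moments and makes this region negligible.
-/

namespace TimeSlice
noncomputable section

variable {d : ℕ}

/-! ### Hermite polynomials and the Stein identity -/

open MvPolynomial in
/-- The linear form `½ (A z)_i`, minus the `i`-th logarithmic derivative of `exp (-¼ zᵀ A z)`. -/
def score (A : Matrix (Fin d) (Fin d) ℝ) (i : Fin d) : MvPolynomial (Fin d) ℝ :=
  ∑ j, C (A i j / 2) * X j

open MvPolynomial in
theorem pderiv_score (A : Matrix (Fin d) (Fin d) ℝ) (i k : Fin d) :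
    pderiv k (score A i) = C (A i k / 2) := by
  classical
  simp [score, Derivation.leibniz, pderiv_X, Pi.single_apply]

open MvPolynomial in
/-- The adjoint `p ↦ ½ (A z)_n p - ∂_n p` of `∂_n` with respect to the weight
`exp (-¼ zᵀ A z)`. Repeated application to `1` produces the Hermite polynomials. -/
def raise (A : Matrix (Fin d) (Fin d) ℝ) (n : Fin d) (p : MvPolynomial (Fin d) ℝ) :
    MvPolynomial (Fin d) ℝ :=
  score A n * p - pderiv n p

/-- The Hermite polynomial of degree one for the weight `exp (-¼ zᵀ A z)`. -/
def herm₁ (A : Matrix (Fin d) (Fin d) ℝ) (i : Fin d) := raise A i 1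
/-- The Hermite polynomials of degree two. -/
def herm₂ (A : Matrix (Fin d) (Fin d) ℝ) (i j : Fin d) := raise A j (herm₁ A i)
/-- The Hermite polynomials of degree three. -/
def herm₃ (A : Matrix (Fin d) (Fin d) ℝ) (i j m : Fin d) := raise A m (herm₂ A i j)
/-- The Hermite polynomials of degree four. -/
def herm₄ (A : Matrix (Fin d) (Fin d) ℝ) (i j m n : Fin d) := raise A n (herm₃ A i j m)

/-- A linear functional on polynomials satisfies the Stein identity of the weight
`exp (-¼ zᵀ A z)` if it integrates by parts like integration against this weight. -/
def IsStein (A : Matrix (Fin d) (Fin d) ℝ) (L : MvPolynomial (Fin d) ℝ →ₗ[ℝ] ℝ) : Prop :=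
  ∀ i p, L (MvPolynomial.pderiv i p) = L (score A i * p)

open MvPolynomial in
/-- Integration by parts: `raise` is the adjoint of the partial derivative. -/
theorem IsStein.apply_mul_raise {A : Matrix (Fin d) (Fin d) ℝ}
    {L : MvPolynomial (Fin d) ℝ →ₗ[ℝ] ℝ} (hL : IsStein A L) (n : Fin d)
    (f p : MvPolynomial (Fin d) ℝ) : L (f * raise A n p) = L (pderiv n f * p) := by
  have h := hL n (f * p)
  rw [Derivation.leibniz, map_add, smul_eq_mul, smul_eq_mul] at h
  have : f * raise A n p = score A n * (f * p) - f * pderiv n p := by rw [raise]; ring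
  rw [this, map_sub, ← h, mul_comm p]
  ring

section Coefficients

open MvPolynomial

variable (A : Matrix (Fin d) (Fin d) ℝ) (q : Fin d → Fin d → Fin d → ℝ)
  (r : Fin d → Fin d → Fin d → Fin d → ℝ) (b : Fin d → ℝ) (B : Fin d → Fin d → ℝ) (c : ℝ)

/-- The linear form with coefficients `a`. -/
def linPoly (a : Fin d → ℝ) : MvPolynomial (Fin d) ℝ := ∑ k, C (a k) * X k

/-- The quadratic form `½ ∑ a_kl z_k z_l`. -/
def quadPoly (a : Fin d → Fin d → ℝ) : MvPolynomial (Fin d) ℝ :=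
  ∑ k, ∑ l, C (a k l / 2) * (X k * X l)

/-- The coefficient of `ε` in the relative expansion of the rescaled kernel: `q i j k` stands for
`∂_k D^{ij}`, and `b` for the drift. -/
def firstPoly : MvPolynomial (Fin d) ℝ :=
  (∑ i, ∑ j, linPoly (q i j) * herm₂ A i j) + ∑ i, C (b i) * herm₁ A i

/-- The coefficient of `ε²` in the relative expansion of the rescaled kernel: in addition to the
data of `firstPoly`, `r i j k l` stands for `∂_k ∂_l D^{ij}`, `B i k` for `∂_k b^i` and `c` for the
potential. -/
def secondPoly : MvPolynomial (Fin d) ℝ :=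
  (∑ i, ∑ j, quadPoly (r i j) * herm₂ A i j)
  + C (1 / 2) * (∑ i, ∑ j, ∑ m, ∑ n, linPoly (q i j) * linPoly (q m n) * herm₄ A i j m n)
  + (∑ i, ∑ j, ∑ m, C (b m) * linPoly (q i j) * herm₃ A i j m)
  + C (1 / 2) * (∑ i, ∑ j, C (b i * b j) * herm₂ A i j)
  + (∑ i, linPoly (B i) * herm₁ A i) + C c

theorem pderiv_linPoly (a : Fin d → ℝ) (k : Fin d) : pderiv k (linPoly a) = C (a k) := by
  classical
  simp [linPoly, Derivation.leibniz, pderiv_X, Pi.single_apply]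

theorem pderiv_quadPoly (a : Fin d → Fin d → ℝ) (k : Fin d) :
    pderiv k (quadPoly a) = linPoly (fun l => (a k l + a l k) / 2) := by
  classical
  simp only [quadPoly, linPoly, map_sum, Derivation.leibniz, pderiv_X, Pi.single_apply, pderiv_C,
    smul_eq_mul, mul_zero, add_zero, mul_ite, mul_one, mul_add, Finset.sum_add_distrib,
    Finset.sum_ite_eq', Finset.sum_ite_irrel, Finset.sum_const_zero, Finset.mem_univ, if_true,
    add_div, map_add, add_mul]
  rw [add_comm]

end Coefficients

section Moments

open MvPolynomial

variable {A : Matrix (Fin d) (Fin d) ℝ} {L : MvPolynomial (Fin d) ℝ →ₗ[ℝ] ℝ}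

theorem apply_C_mul (L : MvPolynomial (Fin d) ℝ →ₗ[ℝ] ℝ) (a : ℝ) (p : MvPolynomial (Fin d) ℝ) :
    L (C a * p) = a * L p := by
  rw [← smul_eq_C_mul, map_smul, smul_eq_mul]

theorem apply_C (L : MvPolynomial (Fin d) ℝ →ₗ[ℝ] ℝ) (a : ℝ) : L (C a) = a * L 1 := by
  rw [← apply_C_mul, mul_one]

theorem IsStein.apply_firstPoly (hL : IsStein A L) (q : Fin d → Fin d → Fin d → ℝ)
    (b : Fin d → ℝ) : L (firstPoly A q b) = 0 := by
  simp only [firstPoly, map_add, map_sum, herm₂, herm₁, hL.apply_mul_raise, pderiv_linPoly,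
    pderiv_C, zero_mul, map_zero, Finset.sum_const_zero, add_zero]

/-- The first moments of the relative correction are the effective drift. -/
theorem IsStein.apply_X_mul_firstPoly (hL : IsStein A L) (q : Fin d → Fin d → Fin d → ℝ)
    (b : Fin d → ℝ) (m : Fin d) :
    L (X m * firstPoly A q b) = ((∑ k, (q m k k + q k m k)) + b m) * L 1 := by
  classical
  simp only [firstPoly, mul_add, map_add, map_sum, herm₂, herm₁, hL.apply_mul_raise,
    pderiv_linPoly, pderiv_C, Finset.mul_sum, ← mul_assoc, Derivation.leibniz, pderiv_X,
    smul_eq_mul, mul_zero, zero_add, Pi.single_apply, mul_ite, mul_one, map_zero,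
    Finset.sum_ite_eq, Finset.mem_univ, if_true,
    apply_ite L, apply_ite (pderiv _), Finset.sum_add_distrib, Finset.sum_ite_irrel,
    Finset.sum_const_zero, apply_C, ← Finset.sum_mul, ← add_mul]

/-- Only the second derivatives of the matrix field, the divergence of the drift and the potential
contribute: in all other terms of `secondPoly` there are more derivatives to move than powers of
`z` to receive them. -/
theorem IsStein.apply_secondPoly (hL : IsStein A L) (q : Fin d → Fin d → Fin d → ℝ)
    (r : Fin d → Fin d → Fin d → Fin d → ℝ) (b : Fin d → ℝ) (B : Fin d → Fin d → ℝ) (c : ℝ) :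
    L (secondPoly A q r b B c) =
      ((∑ i, ∑ j, (r i j j i + r i j i j) / 2) + (∑ i, B i i) + c) * L 1 := by
  simp only [secondPoly, map_add, map_sum, herm₄, herm₃, herm₂, herm₁, apply_C_mul,
    hL.apply_mul_raise, Derivation.leibniz, pderiv_linPoly, pderiv_quadPoly, smul_eq_mul,
    pderiv_C, mul_zero, add_zero, zero_mul, map_zero, Finset.sum_const_zero, mul_one, apply_C,
    ← Finset.sum_mul, ← add_mul]

end Moments

section Eval

open MvPolynomial

theorem herm₂_eq (A : Matrix (Fin d) (Fin d) ℝ) (i j : Fin d) :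
    herm₂ A i j = score A i * score A j - C (A i j / 2) := by
  simp [herm₂, herm₁, raise, pderiv_score, mul_comm]

theorem herm₃_eq (A : Matrix (Fin d) (Fin d) ℝ) (i j m : Fin d) :
    herm₃ A i j m = score A i * score A j * score A m
      - C (A i j / 2) * score A m - C (A i m / 2) * score A j - C (A j m / 2) * score A i := by
  rw [herm₃, raise, herm₂_eq]
  simp only [map_sub, Derivation.leibniz, pderiv_score, pderiv_C, smul_eq_mul]
  ring

/-- All pairings of the four indices, with the product of two quadratic Hermite polynomials split
off: this product is what the square of `firstPoly` produces. -/
theorem herm₄_eq (A : Matrix (Fin d) (Fin d) ℝ) (i j m n : Fin d) :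
    herm₄ A i j m n = herm₂ A i j * herm₂ A m n
      - C (A i m / 2) * score A j * score A n - C (A i n / 2) * score A j * score A m
      - C (A j m / 2) * score A i * score A n - C (A j n / 2) * score A i * score A m
      + C (A i m / 2) * C (A j n / 2) + C (A i n / 2) * C (A j m / 2) := by
  rw [herm₄, raise, herm₃_eq, herm₂_eq, herm₂_eq]
  simp only [map_sub, Derivation.leibniz, pderiv_score, pderiv_C, smul_eq_mul]
  ring

end Eval

/-! ### Contractions of Hermite polynomials -/

section Eval
open MvPolynomial Matrix

theorem trace_mul_mul_eq_sum (A Q : Matrix (Fin d) (Fin d) ℝ) (hA : A.IsSymm) :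
    (A * Q).trace = ∑ i, ∑ j, Q i j * A i j := by
  rw [trace_mul_comm]
  simp only [trace, diag_apply, mul_apply, hA.apply]

theorem dotProduct_mulVec_eq_sum (Q : Matrix (Fin d) (Fin d) ℝ) (v w : Fin d → ℝ) :
    v ⬝ᵥ Q *ᵥ w = ∑ i, ∑ j, Q i j * (v i * w j) := by
  simp only [dotProduct, mulVec, Finset.mul_sum]
  exact Finset.sum_congr rfl fun i _ => Finset.sum_congr rfl fun j _ => by ring

theorem sum_swap_left {Q : Matrix (Fin d) (Fin d) ℝ} (hQ : Q.IsSymm) (f : Fin d → Fin d → ℝ) :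
    ∑ i, ∑ j, Q i j * f j i = ∑ i, ∑ j, Q i j * f i j := by
  rw [Finset.sum_comm]
  simp only [hQ.apply]

theorem sum_herm₂ (A Q : Matrix (Fin d) (Fin d) ℝ) (hA : A.IsSymm) (v : Fin d → ℝ) :
    ∑ i, ∑ j, Q i j * (v i * v j - A i j / 2) = v ⬝ᵥ Q *ᵥ v - (A * Q).trace / 2 := by
  rw [trace_mul_mul_eq_sum A Q hA, dotProduct_mulVec_eq_sum, Finset.sum_div]
  simp only [Finset.sum_div, ← Finset.sum_sub_distrib]
  exact Finset.sum_congr rfl fun i _ => Finset.sum_congr rfl fun j _ => by ring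

theorem sum_herm₃ (A Q : Matrix (Fin d) (Fin d) ℝ) (hA : A.IsSymm) (hQ : Q.IsSymm)
    (v b : Fin d → ℝ) :
    ∑ i, ∑ j, ∑ m, b m * Q i j *
        (v i * v j * v m - A i j / 2 * v m - A i m / 2 * v j - A j m / 2 * v i) =
      (v ⬝ᵥ Q *ᵥ v - (A * Q).trace / 2) * (b ⬝ᵥ v) - v ⬝ᵥ (Q * A) *ᵥ b := by
  have h1 : ∀ w : Fin d → ℝ, ∑ i, ∑ j, Q i j * (w i * v j) = ∑ i, ∑ j, Q i j * (v i * w j) := by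
    intro w
    rw [← sum_swap_left hQ]
    simp only [mul_comm]
  have h2 : v ⬝ᵥ (Q * A) *ᵥ b = ∑ i, ∑ j, Q i j * (v i * ∑ m, A j m * b m) := by
    rw [← mulVec_mulVec, dotProduct_mulVec_eq_sum]
    rfl
  have h3 : v ⬝ᵥ (Q * A) *ᵥ b = ∑ i, ∑ j, Q i j * ((∑ m, A i m * b m) * v j) := by
    rw [h2, h1]
  have h4 : v ⬝ᵥ (Q * A) *ᵥ b = ∑ i, ∑ j, (Q i j * ((∑ m, A i m * b m) * v j) / 2 +
      Q i j * (v i * ∑ m, A j m * b m) / 2) := by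
    simp only [Finset.sum_add_distrib, ← Finset.sum_div, ← h2, ← h3]
    ring
  rw [h4, ← sum_herm₂ A Q hA]
  simp only [Finset.sum_mul, ← Finset.sum_sub_distrib]
  refine Finset.sum_congr rfl fun i _ => Finset.sum_congr rfl fun j _ => ?_
  simp only [dotProduct, Finset.mul_sum, Finset.sum_div, ← Finset.sum_sub_distrib,
    ← Finset.sum_add_distrib]
  exact Finset.sum_congr rfl fun m _ => by ring

theorem sum_herm₄ (A Q : Matrix (Fin d) (Fin d) ℝ) (hA : A.IsSymm) (hQ : Q.IsSymm)
    (v : Fin d → ℝ) :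
    ∑ i, ∑ j, ∑ m, ∑ n, Q i j * Q m n *
        ((v i * v j - A i j / 2) * (v m * v n - A m n / 2)
          - A i m / 2 * v j * v n - A i n / 2 * v j * v m
          - A j m / 2 * v i * v n - A j n / 2 * v i * v m
          + A i m / 2 * (A j n / 2) + A i n / 2 * (A j m / 2)) =
      (v ⬝ᵥ Q *ᵥ v - (A * Q).trace / 2) ^ 2 - 2 * (v ⬝ᵥ (Q * A * Q) *ᵥ v)
        + (A * Q * A * Q).trace / 2 := by
  -- the two kinds of contraction of `Q ⊗ Q` with `A`
  have h1 : v ⬝ᵥ (Q * A * Q) *ᵥ v =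
      ∑ i, ∑ j, Q i j * ∑ m, ∑ n, Q m n * (A j m * v i * v n) := by
    rw [← mulVec_mulVec, ← mulVec_mulVec, dotProduct_mulVec_eq_sum]
    refine Finset.sum_congr rfl fun i _ => Finset.sum_congr rfl fun j _ => ?_
    simp only [mulVec, dotProduct, Finset.mul_sum]
    exact Finset.sum_congr rfl fun m _ => Finset.sum_congr rfl fun n _ => by ring
  have h2 : v ⬝ᵥ (Q * A * Q) *ᵥ v =
      ∑ i, ∑ j, Q i j * ∑ m, ∑ n, Q m n * (A j n * v i * v m) := by
    rw [h1]
    refine Finset.sum_congr rfl fun i _ => Finset.sum_congr rfl fun j _ => ?_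
    rw [sum_swap_left hQ fun m n => A j n * v i * v m]
  have h3 : v ⬝ᵥ (Q * A * Q) *ᵥ v =
      ∑ i, ∑ j, Q i j * ∑ m, ∑ n, Q m n * (A i m * v j * v n) := by
    rw [h1, ← sum_swap_left hQ]
  have h4 : v ⬝ᵥ (Q * A * Q) *ᵥ v =
      ∑ i, ∑ j, Q i j * ∑ m, ∑ n, Q m n * (A i n * v j * v m) := by
    rw [h2, ← sum_swap_left hQ]
  have h5 : (A * Q * A * Q).trace = ∑ i, ∑ j, Q i j * ∑ m, ∑ n, Q m n * (A i n * A j m) := by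
    rw [trace_mul_comm, trace]
    simp only [diag_apply, mul_assoc]
    refine Finset.sum_congr rfl fun i _ => ?_
    rw [mul_apply]
    refine Finset.sum_congr rfl fun j _ => ?_
    rw [mul_apply]
    congr 1
    refine Finset.sum_congr rfl fun m _ => ?_
    rw [mul_apply, Finset.mul_sum]
    refine Finset.sum_congr rfl fun n _ => ?_
    rw [hA.apply i n]
    ring
  have h6 : (A * Q * A * Q).trace = ∑ i, ∑ j, Q i j * ∑ m, ∑ n, Q m n * (A i m * A j n) := by
    rw [h5]
    refine Finset.sum_congr rfl fun i _ => Finset.sum_congr rfl fun j _ => ?_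
    rw [sum_swap_left hQ fun m n => A i m * A j n]
  have h7 : (v ⬝ᵥ Q *ᵥ v - (A * Q).trace / 2) ^ 2 =
      ∑ i, ∑ j, Q i j * ∑ m, ∑ n, Q m n *
        ((v i * v j - A i j / 2) * (v m * v n - A m n / 2)) := by
    rw [← sum_herm₂ A Q hA, sq, Finset.sum_mul]
    refine Finset.sum_congr rfl fun i _ => ?_
    rw [Finset.sum_mul]
    refine Finset.sum_congr rfl fun j _ => ?_
    simp only [Finset.mul_sum]
    exact Finset.sum_congr rfl fun m _ => Finset.sum_congr rfl fun n _ => by ring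
  have h8 : ∀ x y : ℝ, x - 2 * (v ⬝ᵥ (Q * A * Q) *ᵥ v) + y / 2 =
      x - (v ⬝ᵥ (Q * A * Q) *ᵥ v) / 2 - (v ⬝ᵥ (Q * A * Q) *ᵥ v) / 2
        - (v ⬝ᵥ (Q * A * Q) *ᵥ v) / 2 - (v ⬝ᵥ (Q * A * Q) *ᵥ v) / 2 + y / 4 + y / 4 := by
    intro x y; ring
  rw [h8, h7]
  nth_rw 1 [h3]
  nth_rw 1 [h4]
  nth_rw 1 [h1]
  nth_rw 1 [h2]
  nth_rw 1 [h6]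
  nth_rw 1 [h5]
  simp only [Finset.mul_sum, Finset.sum_div, ← Finset.sum_sub_distrib, ← Finset.sum_add_distrib]
  refine Finset.sum_congr rfl fun i _ => Finset.sum_congr rfl fun j _ => ?_
  exact Finset.sum_congr rfl fun m _ => Finset.sum_congr rfl fun n _ => by ring

/-- The value of a polynomial at a point of the coordinate space. -/
def evalAt (z : Coord d) (p : MvPolynomial (Fin d) ℝ) : ℝ := eval (fun i => z i) p

theorem evalAt_score (A : Matrix (Fin d) (Fin d) ℝ) (z : Coord d) (i : Fin d) :
    evalAt z (score A i) = (A *ᵥ z) i / 2 := by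
  simp only [evalAt, score, map_sum, map_mul, eval_C, eval_X, mulVec, dotProduct, Finset.sum_div]
  exact Finset.sum_congr rfl fun j _ => by ring

theorem evalAt_linPoly (a : Fin d → ℝ) (z : Coord d) :
    evalAt z (linPoly a) = ∑ k, a k * z k := by
  simp [evalAt, linPoly]

theorem evalAt_quadPoly (a : Fin d → Fin d → ℝ) (z : Coord d) :
    evalAt z (quadPoly a) = (∑ k, ∑ l, a k l * (z k * z l)) / 2 := by
  simp only [evalAt, quadPoly, map_sum, map_mul, eval_C, eval_X, Finset.sum_div]
  exact Finset.sum_congr rfl fun j _ => Finset.sum_congr rfl fun j _ => by ring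

variable {A Q R : Matrix (Fin d) (Fin d) ℝ} {q : Fin d → Fin d → Fin d → ℝ}
  {r : Fin d → Fin d → Fin d → Fin d → ℝ} {B : Fin d → Fin d → ℝ} {z v β : Fin d → ℝ}

theorem evalAt_firstPoly (hA : A.IsSymm) (b : Fin d → ℝ) (z : Coord d) (v : Fin d → ℝ)
    (hv : ∀ i, evalAt z (score A i) = v i) (hq : ∀ i j, evalAt z (linPoly (q i j)) = Q i j) :
    evalAt z (firstPoly A q b) = v ⬝ᵥ Q *ᵥ v - (A * Q).trace / 2 + b ⬝ᵥ v := by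
  unfold evalAt at *
  simp only [firstPoly, herm₂_eq, herm₁, raise, map_add, map_sum, map_mul, map_sub, hv, hq, eval_C,
    sum_herm₂ A Q hA, mul_one, dotProduct]
  simp

/-- The polynomial `secondPoly` is `½ firstPoly²` plus the second-order coefficient of the exponent,
written out here in terms of `v = ½ A z` and the values `Q`, `R`, `β` of the coefficients of the
expansions of the matrix field and the drift. -/
theorem evalAt_secondPoly (hA : A.IsSymm) (hQ : Q.IsSymm) (b : Fin d → ℝ) (c : ℝ)
    (z : Coord d) (v : Fin d → ℝ)
    (hv : ∀ i, evalAt z (score A i) = v i) (hq : ∀ i j, evalAt z (linPoly (q i j)) = Q i j)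
    (hr : ∀ i j, evalAt z (quadPoly (r i j)) = R i j)
    (hB : ∀ i, evalAt z (linPoly (B i)) = β i) :
    evalAt z (secondPoly A q r b B c) =
      (v ⬝ᵥ Q *ᵥ v - (A * Q).trace / 2 + b ⬝ᵥ v) ^ 2 / 2
      + (v ⬝ᵥ R *ᵥ v - (A * R).trace / 2 - v ⬝ᵥ (Q * A * Q) *ᵥ v + (A * Q * A * Q).trace / 4
        - v ⬝ᵥ (Q * A) *ᵥ b - b ⬝ᵥ A *ᵥ b / 4 + β ⬝ᵥ v + c) := by
  have hb : ∑ i, ∑ j, b i * b j * (v i * v j - A i j / 2) =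
      (b ⬝ᵥ v) ^ 2 - b ⬝ᵥ A *ᵥ b / 2 := by
    rw [dotProduct_mulVec_eq_sum, sq, dotProduct, Finset.sum_mul_sum]
    simp only [Finset.sum_div, ← Finset.sum_sub_distrib]
    exact Finset.sum_congr rfl fun i _ => Finset.sum_congr rfl fun j _ => by ring
  unfold evalAt at *
  simp only [secondPoly, herm₄_eq, herm₃_eq, herm₂_eq, map_add, map_sum, map_mul, map_sub, hv, hq,
    hr, hB, eval_C, sum_herm₂ A R hA, sum_herm₃ A Q hA hQ, sum_herm₄ A Q hA hQ, hb]
  have : ∑ i, β i * eval (fun i => z i) (herm₁ A i) = β ⬝ᵥ v := by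
    simp [herm₁, raise, hv, dotProduct]
  rw [this]
  ring

end Eval

/-! ### Polynomials against Gaussian weights -/

theorem exists_pow_mul_exp_neg_le {s c : ℝ} (hs : 0 < s) (hc : 0 < c) (N : ℕ) (m : ℝ) :
    ∃ K, 0 < K ∧ ∀ x : ℝ, 1 ≤ x → x ^ N * Real.exp (-c * x ^ s) ≤ K * x ^ (-m) := by
  obtain ⟨n, hn⟩ := exists_nat_ge ((N + m) / s)
  refine ⟨n.factorial / c ^ n, by positivity, fun x hx => ?_⟩
  have hx0 : 0 < x := by linarith
  have h1 : x ^ (N + m) ≤ (x ^ s) ^ n := by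
    rw [← Real.rpow_mul_natCast hx0.le]
    exact Real.rpow_le_rpow_of_exponent_le hx ((div_le_iff₀' hs).1 hn)
  have h2 : (c * x ^ s) ^ n / n.factorial ≤ Real.exp (c * x ^ s) :=
    Real.pow_div_factorial_le_exp _ (by positivity) n
  have h3 : x ^ (N + m) ≤ n.factorial / c ^ n * Real.exp (c * x ^ s) := by
    refine h1.trans ?_
    rw [mul_pow, div_le_iff₀ (by positivity)] at h2
    rw [div_mul_eq_mul_div, le_div_iff₀ (by positivity)]
    linarith
  rw [neg_mul, Real.exp_neg, Real.rpow_neg hx0.le, ← div_eq_mul_inv, ← div_eq_mul_inv,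
    div_le_div_iff₀ (by positivity) (by positivity), ← Real.rpow_natCast x N,
    ← Real.rpow_add hx0]
  exact h3

theorem integrable_pow_mul_exp_neg_rpow {s c : ℝ} (hs : 0 < s) (hc : 0 < c) (N : ℕ) :
    Integrable fun z : Coord d => (1 + ‖z‖) ^ N * Real.exp (-c * (1 + ‖z‖) ^ s) := by
  obtain ⟨K, -, hK⟩ := exists_pow_mul_exp_neg_le hs hc N (d + 1)
  have hi : Integrable fun z : Coord d => (1 + ‖z‖) ^ (-(d + 1 : ℝ)) :=
    integrable_one_add_norm (by simp)
  refine (hi.const_mul K).mono' (Measurable.aestronglyMeasurable (by fun_prop)) ?_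
  refine ae_of_all _ fun z => ?_
  have hz : 1 ≤ 1 + ‖z‖ := by linarith [norm_nonneg z]
  rw [Real.norm_of_nonneg (by positivity)]
  exact hK _ hz

theorem integrable_pow_mul_exp_neg_sq {c : ℝ} (hc : 0 < c) (N : ℕ) :
    Integrable fun z : Coord d => (1 + ‖z‖) ^ N * Real.exp (-c * ‖z‖ ^ 2) := by
  have hi := (integrable_pow_mul_exp_neg_rpow (d := d) two_pos (half_pos hc) N).const_mul
    (Real.exp c)
  refine hi.mono' (Measurable.aestronglyMeasurable (by fun_prop)) ?_
  refine ae_of_all _ fun z => ?_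
  rw [Real.norm_of_nonneg (by positivity), mul_left_comm, ← Real.exp_add]
  gcongr
  rw [Real.rpow_two]
  nlinarith [sq_nonneg (‖z‖ - 1)]

/-- `f` grows at most polynomially. -/
def PolyBdd (f : Coord d → ℝ) : Prop := ∃ K, ∃ N : ℕ, 0 ≤ K ∧ ∀ z, |f z| ≤ K * (1 + ‖z‖) ^ N

theorem one_le_one_add_norm (z : Coord d) : 1 ≤ 1 + ‖z‖ := by linarith [norm_nonneg z]

theorem abs_apply_le_norm (z : Coord d) (i : Fin d) : |z i| ≤ ‖z‖ := by
  simpa using PiLp.norm_apply_le z i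

theorem PolyBdd.const (a : ℝ) : PolyBdd fun _ : Coord d => a :=
  ⟨|a|, 0, abs_nonneg a, by simp⟩

theorem PolyBdd.coord (i : Fin d) : PolyBdd fun z : Coord d => z i :=
  ⟨1, 1, zero_le_one, fun z => by simpa using (abs_apply_le_norm z i).trans (by linarith)⟩

theorem PolyBdd.add {f g : Coord d → ℝ} (hf : PolyBdd f) (hg : PolyBdd g) :
    PolyBdd fun z => f z + g z := by
  obtain ⟨K, N, hK, hf⟩ := hf
  obtain ⟨K', N', hK', hg⟩ := hg
  refine ⟨K + K', max N N', by positivity, fun z => (abs_add_le _ _).trans ?_⟩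
  rw [add_mul]
  have := one_le_one_add_norm z
  gcongr
  · exact (hf z).trans (by gcongr; exact le_max_left _ _)
  · exact (hg z).trans (by gcongr; exact le_max_right _ _)

theorem PolyBdd.mul {f g : Coord d → ℝ} (hf : PolyBdd f) (hg : PolyBdd g) :
    PolyBdd fun z => f z * g z := by
  obtain ⟨K, N, hK, hf⟩ := hf
  obtain ⟨K', N', hK', hg⟩ := hg
  refine ⟨K * K', N + N', by positivity, fun z => ?_⟩
  rw [abs_mul, pow_add, mul_mul_mul_comm]
  exact mul_le_mul (hf z) (hg z) (abs_nonneg _) (by positivity)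

theorem polyBdd_evalAt (p : MvPolynomial (Fin d) ℝ) : PolyBdd fun z : Coord d => evalAt z p := by
  induction p using MvPolynomial.induction_on with
  | C a => simpa [evalAt] using PolyBdd.const a
  | add p q hp hq => simpa [evalAt] using hp.add hq
  | mul_X p i hp => simpa [evalAt] using hp.mul (PolyBdd.coord i)

theorem differentiable_evalAt_and_pd (p : MvPolynomial (Fin d) ℝ) :
    Differentiable ℝ (fun z : Coord d => evalAt z p) ∧ ∀ (z : Coord d) (i : Fin d),
      pd i (fun z : Coord d => evalAt z p) z = evalAt z (MvPolynomial.pderiv i p) := by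
  classical
  induction p using MvPolynomial.induction_on with
  | C a => simp [evalAt, pd]
  | add p q hp hq =>
    have h : (fun z : Coord d => evalAt z (p + q)) = fun z => evalAt z p + evalAt z q := by
      simp [evalAt]
    refine ⟨h ▸ hp.1.add hq.1, fun z i => ?_⟩
    have h1 := hp.2 z i
    have h2 := hq.2 z i
    rw [pd] at h1 h2 ⊢
    rw [h, fderiv_fun_add (hp.1 z) (hq.1 z), add_apply, h1, h2]
    simp [evalAt]
  | mul_X p j hp =>
    have h : (fun z : Coord d => evalAt z (p * MvPolynomial.X j)) =
        fun z => evalAt z p * z j := by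
      simp [evalAt]
    have hj : Differentiable ℝ fun z : Coord d => z j := by fun_prop
    refine ⟨h ▸ hp.1.mul hj, fun z i => ?_⟩
    have h1 := hp.2 z i
    have h2 : fderiv ℝ (fun z : Coord d => z j) z =
        (EuclideanSpace.proj j : Coord d →L[ℝ] ℝ) :=
      (EuclideanSpace.proj j : Coord d →L[ℝ] ℝ).fderiv
    rw [pd] at h1 ⊢
    rw [h, fderiv_fun_mul (hp.1 z) (hj z), add_apply,
      smul_apply, smul_apply, h1, h2]
    simp [evalAt, Derivation.leibniz, MvPolynomial.pderiv_X, Pi.single_apply,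
      apply_ite (MvPolynomial.eval _)]

theorem PolyBdd.integrable_mul {f g : Coord d → ℝ} (hf : PolyBdd f) (hfc : Continuous f)
    (hgc : Continuous g) {K c : ℝ} (hc : 0 < c)
    (hg : ∀ z, |g z| ≤ K * Real.exp (-c * ‖z‖ ^ 2)) : Integrable fun z => f z * g z := by
  obtain ⟨K', N, hK', hf⟩ := hf
  refine ((integrable_pow_mul_exp_neg_sq hc N).const_mul (K' * K)).mono'
    (hfc.mul hgc).aestronglyMeasurable (ae_of_all _ fun z => ?_)
  rw [Real.norm_eq_abs, abs_mul, mul_mul_mul_comm]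
  exact mul_le_mul (hf z) (hg z) (abs_nonneg _) (by positivity)

/-- The quadratic form of a matrix. -/
def quadForm (A : Matrix (Fin d) (Fin d) ℝ) (z : Fin d → ℝ) : ℝ := ∑ i, ∑ j, z i * A i j * z j

/-- The unnormalized Gaussian weight `exp (s - ¼ zᵀ A z)`. -/
def gaussWeight (s : ℝ) (A : Matrix (Fin d) (Fin d) ℝ) (z : Coord d) : ℝ :=
  Real.exp (s - quadForm A z / 4)

theorem continuous_quadForm (A : Matrix (Fin d) (Fin d) ℝ) :
    Continuous fun z : Coord d => quadForm A z := by
  unfold quadForm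
  fun_prop

theorem continuous_gaussWeight (s : ℝ) (A : Matrix (Fin d) (Fin d) ℝ) :
    Continuous (gaussWeight s A) :=
  Real.continuous_exp.comp (continuous_const.sub ((continuous_quadForm A).div_const 4))

theorem gaussWeight_le {s lam : ℝ} {A : Matrix (Fin d) (Fin d) ℝ}
    (hA : ∀ z : Coord d, lam * ‖z‖ ^ 2 ≤ quadForm A z) (z : Coord d) :
    |gaussWeight s A z| ≤ Real.exp s * Real.exp (-(lam / 4) * ‖z‖ ^ 2) := by
  rw [gaussWeight, Real.abs_exp, ← Real.exp_add, Real.exp_le_exp]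
  linarith [hA z]

theorem continuous_evalAt (p : MvPolynomial (Fin d) ℝ) :
    Continuous fun z : Coord d => evalAt z p :=
  (differentiable_evalAt_and_pd p).1.continuous

theorem integrable_evalAt_mul_gaussWeight {s lam : ℝ} {A : Matrix (Fin d) (Fin d) ℝ}
    (hlam : 0 < lam) (hA : ∀ z : Coord d, lam * ‖z‖ ^ 2 ≤ quadForm A z)
    (p : MvPolynomial (Fin d) ℝ) : Integrable fun z : Coord d => evalAt z p * gaussWeight s A z :=
  (polyBdd_evalAt p).integrable_mul (continuous_evalAt p) (continuous_gaussWeight s A)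
    (by positivity) (gaussWeight_le hA)

theorem differentiable_gaussWeight_and_pd (s : ℝ) {A : Matrix (Fin d) (Fin d) ℝ} (hA : A.IsSymm)
    (z : Coord d) (i : Fin d) :
    Differentiable ℝ (gaussWeight s A) ∧
      pd i (gaussWeight s A) z = - (evalAt z (score A i) * gaussWeight s A z) := by
  classical
  have hq : ∀ z : Coord d, HasFDerivAt (fun z : Coord d => quadForm A z)
      (∑ i, ∑ j, ((z i * A i j) • (EuclideanSpace.proj j : Coord d →L[ℝ] ℝ) +
        z j • (A i j • (EuclideanSpace.proj i : Coord d →L[ℝ] ℝ)))) z := by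
    intro z
    unfold quadForm
    refine HasFDerivAt.fun_sum fun i _ => HasFDerivAt.fun_sum fun j _ => ?_
    exact ((EuclideanSpace.proj i : Coord d →L[ℝ] ℝ).hasFDerivAt.mul_const (A i j)).mul
      (EuclideanSpace.proj j : Coord d →L[ℝ] ℝ).hasFDerivAt
  have hg : ∀ z : Coord d, HasFDerivAt (gaussWeight s A) _ z := fun z =>
    (((hq z).mul_const (1 / 4)).const_sub s).exp.congr_of_eventuallyEq
      (Eventually.of_forall fun z => by simp [gaussWeight, div_eq_mul_inv])
  refine ⟨fun z => (hg z).differentiableAt, ?_⟩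
  have hproj : ∀ j, (EuclideanSpace.proj j : Coord d →L[ℝ] ℝ) (EuclideanSpace.single i 1) =
      if j = i then 1 else 0 := by
    intro j
    simp
  rw [pd, (hg z).fderiv, evalAt_score]
  simp only [Finset.sum_add_distrib, smul_apply, neg_apply,
    add_apply, sum_apply, hproj,
    smul_eq_mul, mul_ite, mul_one, mul_zero, Finset.sum_ite_eq',
    Finset.mem_univ, if_true, Finset.sum_ite_irrel, Finset.sum_const_zero, Matrix.mulVec,
    dotProduct, gaussWeight]
  have : ∑ x, z x * A x i = ∑ x, A i x * z x :=
    Finset.sum_congr rfl fun x _ => by rw [hA.apply i x, mul_comm]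
  have h2 : ∑ x, z x * A i x = ∑ x, A i x * z x :=
    Finset.sum_congr rfl fun x _ => by rw [mul_comm]
  simp only [this, h2, div_eq_mul_inv]
  ring_nf

/-- Integration of polynomials against a Gaussian weight, as a linear functional. -/
def gaussFunctional (s : ℝ) (A : Matrix (Fin d) (Fin d) ℝ) {lam : ℝ} (hlam : 0 < lam)
    (hA : ∀ z : Coord d, lam * ‖z‖ ^ 2 ≤ quadForm A z) : MvPolynomial (Fin d) ℝ →ₗ[ℝ] ℝ where
  toFun p := ∫ z : Coord d, evalAt z p * gaussWeight s A z
  map_add' p q := by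
    rw [← integral_add (integrable_evalAt_mul_gaussWeight hlam hA p)
      (integrable_evalAt_mul_gaussWeight hlam hA q)]
    simp [evalAt, add_mul]
  map_smul' a p := by
    rw [RingHom.id_apply, smul_eq_mul, ← integral_const_mul]
    simp [evalAt, mul_assoc, MvPolynomial.smul_eval]

theorem isStein_gaussFunctional (s : ℝ) {A : Matrix (Fin d) (Fin d) ℝ} (hsymm : A.IsSymm)
    {lam : ℝ} (hlam : 0 < lam) (hA : ∀ z : Coord d, lam * ‖z‖ ^ 2 ≤ quadForm A z) :
    IsStein A (gaussFunctional s A hlam hA) := by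
  intro i p
  have hi := integrable_evalAt_mul_gaussWeight (s := s) hlam hA
  have h1 : ∀ z : Coord d, fderiv ℝ (fun z : Coord d => evalAt z p) z
      (EuclideanSpace.single i 1) = evalAt z (MvPolynomial.pderiv i p) :=
    fun z => (differentiable_evalAt_and_pd p).2 z i
  have h2 : ∀ z : Coord d, fderiv ℝ (gaussWeight s A) z (EuclideanSpace.single i 1) =
      -(evalAt z (score A i) * gaussWeight s A z) :=
    fun z => (differentiable_gaussWeight_and_pd s hsymm z i).2
  have h3 : ∀ z : Coord d, evalAt z p * -(evalAt z (score A i) * gaussWeight s A z) =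
      -(evalAt z (score A i * p) * gaussWeight s A z) := by
    intro z; simp only [evalAt, map_mul]; ring
  have key := integral_mul_fderiv_eq_neg_fderiv_mul_of_integrable (μ := volume)
    (f := fun z : Coord d => evalAt z p) (g := gaussWeight s A) (v := EuclideanSpace.single i 1)
    (by simpa only [h1] using hi _) (by simp only [h2, h3]; exact (hi _).neg) (hi p)
    (fun z _ => (differentiable_evalAt_and_pd p).1 z)
    (fun z _ => (differentiable_gaussWeight_and_pd s hsymm z i).1 z)
  simp only [h1, h2, h3, integral_neg, neg_inj] at key
  exact key.symm

/-! ### Second-order expansions of rescaled functions -/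

/-- The family `φ ε` has the second-order expansion `φ₀ + ε φ₁ + ε² φ₂` as `ε → 0⁺`: pointwise with
error `o(ε²)`, and with an error of size `ε²` times a polynomial on the region `ε ‖z‖ ≤ δ`. -/
def Expands (δ : ℝ) (φ : ℝ → Coord d → ℝ) (φ₀ φ₁ φ₂ : Coord d → ℝ) : Prop :=
  ∃ (r : ℝ → Coord d → ℝ) (K : ℝ) (N : ℕ), 0 ≤ K ∧
    (∀ z, |φ₀ z| ≤ K * (1 + ‖z‖) ^ N) ∧ (∀ z, |φ₁ z| ≤ K * (1 + ‖z‖) ^ N) ∧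
    (∀ ε z, 0 < ε → ε ≤ 1 → ε * ‖z‖ ≤ δ → |r ε z| ≤ K * (1 + ‖z‖) ^ N) ∧
    (∀ ε z, 0 < ε → φ ε z = φ₀ z + ε * φ₁ z + ε ^ 2 * r ε z) ∧
    ∀ z, Tendsto (fun ε => r ε z) (𝓝[>] 0) (𝓝 (φ₂ z))

theorem Expands.add {δ : ℝ} {φ ψ : ℝ → Coord d → ℝ} {φ₀ φ₁ φ₂ ψ₀ ψ₁ ψ₂ : Coord d → ℝ}
    (h : Expands δ φ φ₀ φ₁ φ₂) (h' : Expands δ ψ ψ₀ ψ₁ ψ₂) :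
    Expands δ (fun ε z => φ ε z + ψ ε z) (fun z => φ₀ z + ψ₀ z) (fun z => φ₁ z + ψ₁ z)
      (fun z => φ₂ z + ψ₂ z) := by
  obtain ⟨r, K, N, hK, h0, h1, hr, he, hl⟩ := h
  obtain ⟨r', K', N', hK', h0', h1', hr', he', hl'⟩ := h'
  have key : ∀ {a b : ℝ} (z : Coord d), |a| ≤ K * (1 + ‖z‖) ^ N → |b| ≤ K' * (1 + ‖z‖) ^ N' →
      |a + b| ≤ (K + K') * (1 + ‖z‖) ^ max N N' := by
    intro a b z ha hb
    have := one_le_one_add_norm z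
    refine (abs_add_le a b).trans ?_
    rw [add_mul]
    gcongr
    · exact ha.trans (by gcongr; exact le_max_left _ _)
    · exact hb.trans (by gcongr; exact le_max_right _ _)
  refine ⟨fun ε z => r ε z + r' ε z, K + K', max N N', by positivity, fun z => key z (h0 z) (h0' z),
    fun z => key z (h1 z) (h1' z), fun ε z h2 h3 h4 => key z (hr ε z h2 h3 h4) (hr' ε z h2 h3 h4),
    fun ε z h2 => ?_, fun z => (hl z).add (hl' z)⟩
  beta_reduce
  rw [he ε z h2, he' ε z h2]
  ring

theorem Expands.mul {δ : ℝ} {φ ψ : ℝ → Coord d → ℝ} {φ₀ φ₁ φ₂ ψ₀ ψ₁ ψ₂ : Coord d → ℝ}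
    (h : Expands δ φ φ₀ φ₁ φ₂) (h' : Expands δ ψ ψ₀ ψ₁ ψ₂) :
    Expands δ (fun ε z => φ ε z * ψ ε z) (fun z => φ₀ z * ψ₀ z)
      (fun z => φ₀ z * ψ₁ z + φ₁ z * ψ₀ z)
      (fun z => φ₀ z * ψ₂ z + φ₁ z * ψ₁ z + φ₂ z * ψ₀ z) := by
  obtain ⟨r, K, N, hK, h0, h1, hr, he, hl⟩ := h
  obtain ⟨r', K', N', hK', h0', h1', hr', he', hl'⟩ := h'
  have hX : ∀ z : Coord d, 0 ≤ K * K' * (1 + ‖z‖) ^ (N + N') := fun z => by positivity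
  have key : ∀ {a b : ℝ} (z : Coord d), |a| ≤ K * (1 + ‖z‖) ^ N → |b| ≤ K' * (1 + ‖z‖) ^ N' →
      |a * b| ≤ K * K' * (1 + ‖z‖) ^ (N + N') := by
    intro a b z ha hb
    rw [abs_mul, pow_add, mul_mul_mul_comm]
    exact mul_le_mul ha hb (abs_nonneg _) (by positivity)
  refine ⟨fun ε z => φ₀ z * r' ε z + φ₁ z * ψ₁ z + r ε z * ψ₀ z +
    ε * (φ₁ z * r' ε z + r ε z * ψ₁ z) + ε ^ 2 * (r ε z * r' ε z), 6 * (K * K'), N + N',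
    by positivity, fun z => ?_, fun z => ?_, fun ε z h2 h3 h4 => ?_, fun ε z h2 => ?_, fun z => ?_⟩
  · exact (key z (h0 z) (h0' z)).trans (by linarith [hX z])
  · refine (abs_add_le _ _).trans ?_
    linarith [hX z, key z (h0 z) (h1' z), key z (h1 z) (h0' z)]
  · have e1 := key z (h0 z) (hr' ε z h2 h3 h4)
    have e2 := key z (h1 z) (h1' z)
    have e3 := key z (hr ε z h2 h3 h4) (h0' z)
    have e4 := key z (h1 z) (hr' ε z h2 h3 h4)
    have e5 := key z (hr ε z h2 h3 h4) (h1' z)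
    have e6 := key z (hr ε z h2 h3 h4) (hr' ε z h2 h3 h4)
    have e7 : |ε * (φ₁ z * r' ε z + r ε z * ψ₁ z)| ≤ |φ₁ z * r' ε z| + |r ε z * ψ₁ z| := by
      rw [abs_mul, abs_of_pos h2]
      exact (mul_le_of_le_one_left (abs_nonneg _) h3).trans (abs_add_le _ _)
    have e8 : |ε ^ 2 * (r ε z * r' ε z)| ≤ |r ε z * r' ε z| := by
      rw [abs_mul, abs_of_pos (by positivity)]
      exact mul_le_of_le_one_left (abs_nonneg _) (pow_le_one₀ h2.le h3)
    refine (abs_add_le _ _).trans ?_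
    have e9 := abs_add_le (φ₀ z * r' ε z + φ₁ z * ψ₁ z + r ε z * ψ₀ z)
      (ε * (φ₁ z * r' ε z + r ε z * ψ₁ z))
    have e10 := abs_add_three (φ₀ z * r' ε z) (φ₁ z * ψ₁ z) (r ε z * ψ₀ z)
    linarith
  · beta_reduce
    rw [he ε z h2, he' ε z h2]
    ring
  · have hε : Tendsto (fun ε : ℝ => ε) (𝓝[>] 0) (𝓝 0) :=
      tendsto_nhdsWithin_of_tendsto_nhds tendsto_id
    have := (((((hl' z).const_mul (φ₀ z)).add_const (φ₁ z * ψ₁ z)).add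
      ((hl z).mul_const (ψ₀ z))).add (hε.mul (((hl' z).const_mul (φ₁ z)).add
        ((hl z).mul_const (ψ₁ z))))).add ((hε.pow 2).mul ((hl z).mul (hl' z)))
    simpa using this

theorem PolyBdd.expands {f : Coord d → ℝ} (hf : PolyBdd f) (δ : ℝ) :
    Expands δ (fun _ => f) f (fun _ => 0) (fun _ => 0) := by
  obtain ⟨K, N, hK, hf⟩ := hf
  refine ⟨fun _ _ => 0, K, N, hK, hf, fun z => ?_, fun ε z _ _ _ => ?_, fun ε z _ => by simp,
    fun z => tendsto_const_nhds⟩ <;>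
  · rw [abs_zero]; positivity

theorem Expands.sum {ι : Type*} (s : Finset ι) {δ : ℝ} {φ : ι → ℝ → Coord d → ℝ}
    {φ₀ φ₁ φ₂ : ι → Coord d → ℝ} (h : ∀ i, Expands δ (φ i) (φ₀ i) (φ₁ i) (φ₂ i)) :
    Expands δ (fun ε z => ∑ i ∈ s, φ i ε z) (fun z => ∑ i ∈ s, φ₀ i z) (fun z => ∑ i ∈ s, φ₁ i z)
      (fun z => ∑ i ∈ s, φ₂ i z) := by
  classical
  induction s using Finset.induction_on with
  | empty => simpa using (PolyBdd.const 0).expands δ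
  | insert i s hi ih => simpa only [Finset.sum_insert hi] using (h i).add ih

theorem Expands.const_mul {δ : ℝ} {φ : ℝ → Coord d → ℝ} {φ₀ φ₁ φ₂ : Coord d → ℝ}
    (h : Expands δ φ φ₀ φ₁ φ₂) (a : ℝ) :
    Expands δ (fun ε z => a * φ ε z) (fun z => a * φ₀ z) (fun z => a * φ₁ z)
      (fun z => a * φ₂ z) := by
  simpa using ((PolyBdd.const a).expands δ).mul h

theorem Expands.sub {δ : ℝ} {φ ψ : ℝ → Coord d → ℝ} {φ₀ φ₁ φ₂ ψ₀ ψ₁ ψ₂ : Coord d → ℝ}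
    (h : Expands δ φ φ₀ φ₁ φ₂) (h' : Expands δ ψ ψ₀ ψ₁ ψ₂) :
    Expands δ (fun ε z => φ ε z - ψ ε z) (fun z => φ₀ z - ψ₀ z) (fun z => φ₁ z - ψ₁ z)
      (fun z => φ₂ z - ψ₂ z) := by
  simpa [sub_eq_add_neg] using h.add (h'.const_mul (-1))

theorem tendsto_smul_nhdsGT (z : Coord d) :
    Tendsto (fun ε : ℝ => ε • z) (𝓝[>] 0) (𝓝 0) := by
  have : Tendsto (fun ε : ℝ => ε • z) (𝓝 0) (𝓝 ((0 : ℝ) • z)) :=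
    (continuous_id.smul continuous_const).tendsto 0
  rw [zero_smul] at this
  exact this.mono_left nhdsWithin_le_nhds

/-- A function with a second-order Taylor expansion at the origin, rescaled. -/
theorem expands_of_isLittleO_sq {f : Coord d → ℝ} {f₀ : ℝ} {f₁ : Coord d →L[ℝ] ℝ}
    {f₂ : Coord d →L[ℝ] Coord d →L[ℝ] ℝ}
    (h : (fun h => f h - f₀ - f₁ h - f₂ h h / 2) =o[𝓝 0] fun h => ‖h‖ ^ 2) :
    ∀ᶠ δ in 𝓝[>] (0 : ℝ), Expands δ (fun ε z => f (ε • z)) (fun _ => f₀) (fun z => f₁ z)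
      (fun z => f₂ z z / 2) := by
  obtain ⟨η, hη, hb⟩ := Metric.eventually_nhds_iff_ball.1 (h.bound one_pos)
  filter_upwards [Ioo_mem_nhdsGT hη] with δ hδ
  refine ⟨fun ε z => f₂ z z / 2 + (f (ε • z) - f₀ - f₁ (ε • z) - f₂ (ε • z) (ε • z) / 2) / ε ^ 2,
    |f₀| + ‖f₁‖ + ‖f₂‖ + 1, 2, by positivity, fun z => ?_, fun z => ?_, fun ε z h1 h2 h3 => ?_,
    fun ε z h1 => ?_, fun z => ?_⟩
  · have h1 : (1 : ℝ) ≤ (1 + ‖z‖) ^ 2 := one_le_pow₀ (one_le_one_add_norm z)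
    nlinarith [abs_nonneg f₀, norm_nonneg f₁, norm_nonneg f₂]
  · have h1 : ‖z‖ ≤ (1 + ‖z‖) ^ 2 := by nlinarith [norm_nonneg z]
    calc |f₁ z| ≤ ‖f₁‖ * ‖z‖ := f₁.le_opNorm z
      _ ≤ (|f₀| + ‖f₁‖ + ‖f₂‖ + 1) * (1 + ‖z‖) ^ 2 := by
          gcongr
          linarith [abs_nonneg f₀, norm_nonneg f₂]
  · have h4 : ‖ε • z‖ = ε * ‖z‖ := by rw [norm_smul, Real.norm_of_nonneg h1.le]
    have h5 := hb (ε • z) (by rw [mem_ball_zero_iff, h4]; exact h3.trans_lt hδ.2)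
    rw [one_mul, Real.norm_eq_abs, h4, Real.norm_of_nonneg (by positivity), mul_pow] at h5
    have h6 : |(f (ε • z) - f₀ - f₁ (ε • z) - f₂ (ε • z) (ε • z) / 2) / ε ^ 2| ≤ ‖z‖ ^ 2 := by
      rw [abs_div, abs_of_pos (pow_pos h1 2), div_le_iff₀ (by positivity)]
      linarith
    have h7 : |f₂ z z / 2| ≤ ‖f₂‖ * ‖z‖ ^ 2 := by
      have := f₂.le_opNorm₂ z z
      rw [Real.norm_eq_abs] at this
      rw [abs_div, abs_two]
      have h8 : 0 ≤ ‖f₂‖ * ‖z‖ * ‖z‖ := by positivity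
      nlinarith
    refine (abs_add_le _ _).trans ?_
    have h9 : ‖z‖ ^ 2 ≤ (1 + ‖z‖) ^ 2 := by gcongr; linarith
    calc |f₂ z z / 2| + _ ≤ (‖f₂‖ + 1) * ‖z‖ ^ 2 := by linarith
      _ ≤ _ := by
        gcongr
        linarith [abs_nonneg f₀, norm_nonneg f₁]
  · simp only [map_smul, smul_apply, smul_eq_mul]
    field_simp
    ring
  · have h1 : (fun ε : ℝ => f (ε • z) - f₀ - f₁ (ε • z) - f₂ (ε • z) (ε • z) / 2)
        =o[𝓝[>] 0] fun ε : ℝ => ε ^ 2 := by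
      refine (h.comp_tendsto (tendsto_smul_nhdsGT z)).trans_isBigO ?_
      refine IsBigO.of_bound (‖z‖ ^ 2) (Eventually.of_forall fun ε => ?_)
      simp [norm_smul, mul_pow, mul_comm]
    simpa using (tendsto_const_nhds (x := f₂ z z / 2)).add h1.tendsto_div_nhds_zero

/-- A function with a first-order Taylor expansion at the origin, rescaled and multiplied
by `ε`. -/
theorem expands_of_isLittleO {f : Coord d → ℝ} {f₀ : ℝ} {f₁ : Coord d →L[ℝ] ℝ}
    (h : (fun h => f h - f₀ - f₁ h) =o[𝓝 0] fun h => ‖h‖) :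
    ∀ᶠ δ in 𝓝[>] (0 : ℝ), Expands δ (fun ε z => ε * f (ε • z)) (fun _ => 0) (fun _ => f₀)
      (fun z => f₁ z) := by
  obtain ⟨η, hη, hb⟩ := Metric.eventually_nhds_iff_ball.1 (h.bound one_pos)
  filter_upwards [Ioo_mem_nhdsGT hη] with δ hδ
  refine ⟨fun ε z => f₁ z + (f (ε • z) - f₀ - f₁ (ε • z)) / ε,
    |f₀| + ‖f₁‖ + 1, 1, by positivity, fun z => ?_, fun z => ?_, fun ε z h1 h2 h3 => ?_,
    fun ε z h1 => ?_, fun z => ?_⟩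
  · rw [abs_zero]; positivity
  · nlinarith [abs_nonneg f₀, norm_nonneg f₁, norm_nonneg z]
  · have h4 : ‖ε • z‖ = ε * ‖z‖ := by rw [norm_smul, Real.norm_of_nonneg h1.le]
    have h5 := hb (ε • z) (by rw [mem_ball_zero_iff, h4]; exact h3.trans_lt hδ.2)
    rw [one_mul, Real.norm_eq_abs, h4, Real.norm_of_nonneg (by positivity)] at h5
    have h6 : |(f (ε • z) - f₀ - f₁ (ε • z)) / ε| ≤ ‖z‖ := by
      rw [abs_div, abs_of_pos h1, div_le_iff₀ h1]
      linarith
    have h7 : |f₁ z| ≤ ‖f₁‖ * ‖z‖ := f₁.le_opNorm z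
    refine (abs_add_le _ _).trans ?_
    nlinarith [abs_nonneg f₀, norm_nonneg f₁, norm_nonneg z]
  · simp only [map_smul, smul_eq_mul]
    field_simp
    ring
  · have h1 : (fun ε : ℝ => f (ε • z) - f₀ - f₁ (ε • z)) =o[𝓝[>] 0] fun ε : ℝ => ε := by
      refine (h.comp_tendsto (tendsto_smul_nhdsGT z)).trans_isBigO ?_
      refine IsBigO.of_bound ‖z‖ (Eventually.of_forall fun ε => ?_)
      simp [norm_smul, mul_comm]
    simpa using (tendsto_const_nhds (x := f₁ z)).add h1.tendsto_div_nhds_zero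

/-- A function that is continuous at the origin, rescaled and multiplied by `ε²`. -/
theorem expands_of_continuousAt {f : Coord d → ℝ} (h : ContinuousAt f 0) :
    ∀ᶠ δ in 𝓝[>] (0 : ℝ), Expands δ (fun ε z => ε ^ 2 * f (ε • z)) (fun _ => 0) (fun _ => 0)
      (fun _ => f 0) := by
  obtain ⟨η, hη, hb⟩ := Metric.continuousAt_iff.1 h 1 one_pos
  filter_upwards [Ioo_mem_nhdsGT hη] with δ hδ
  refine ⟨fun ε z => f (ε • z), |f 0| + 1, 0, by positivity, by simp; positivity,
    by simp; positivity, fun ε z h1 h2 h3 => ?_, by simp,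
    fun z => h.tendsto.comp (tendsto_smul_nhdsGT z)⟩
  have h5 := hb (x := ε • z) (by
    rw [dist_zero_right, norm_smul, Real.norm_of_nonneg h1.le]; exact h3.trans_lt hδ.2)
  rw [Real.dist_eq] at h5
  have := abs_sub_abs_le_abs_sub (f (ε • z)) (f 0)
  rw [pow_zero]
  linarith

/-- A bound that remains useful for large `t`: against a weight `g₀` it only involves `g₀` and
`g₀ exp t`, both of which are dominated by Gaussians. -/
theorem abs_exp_sub_one_sub_le (t : ℝ) : |Real.exp t - 1 - t| ≤ t ^ 2 * (1 + Real.exp t) := by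
  have he := Real.exp_pos t
  rcases le_total |t| 1 with h | h
  · exact (Real.abs_exp_sub_one_sub_id_le h).trans (by nlinarith [sq_nonneg t])
  · have h0 : 0 ≤ Real.exp t - 1 - t := by linarith [Real.add_one_le_exp t]
    have h2 : |t| ≤ t ^ 2 := by rw [← sq_abs]; nlinarith [abs_nonneg t]
    rw [abs_of_nonneg h0]
    nlinarith [neg_abs_le t]

/-- The second-order coefficient of the exponential of `ε p + ε² q + o(ε²)`. -/
theorem tendsto_exp_sub_one_sub_div {t : ℝ → ℝ} {p q : ℝ} {r : ℝ → ℝ}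
    (ht : ∀ ε, 0 < ε → t ε = ε * p + ε ^ 2 * r ε) (hr : Tendsto r (𝓝[>] 0) (𝓝 q)) :
    Tendsto (fun ε => (Real.exp (t ε) - 1 - ε * p) / ε ^ 2) (𝓝[>] 0) (𝓝 (p ^ 2 / 2 + q)) := by
  have hε : Tendsto (fun ε : ℝ => ε) (𝓝[>] 0) (𝓝 0) :=
    tendsto_nhdsWithin_of_tendsto_nhds tendsto_id
  have h1 : Tendsto (fun ε => p + ε * r ε) (𝓝[>] 0) (𝓝 p) := by
    simpa using (hε.mul hr).const_add p
  have h2 : Tendsto t (𝓝[>] 0) (𝓝 0) := by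
    have : Tendsto (fun ε => ε * (p + ε * r ε)) (𝓝[>] 0) (𝓝 0) := by simpa using hε.mul h1
    refine this.congr' ?_
    filter_upwards [self_mem_nhdsWithin] with ε h
    rw [ht ε h]; ring
  -- the quadratic Taylor polynomial of `exp`
  have h3 : (fun x : ℝ => Real.exp x - 1 - x - x ^ 2 / 2) =o[𝓝 0] fun x => x ^ 2 := by
    have : (fun x : ℝ => Real.exp x - 1 - x - x ^ 2 / 2) =O[𝓝 0] fun x => x ^ 3 := by
      refine IsBigO.of_bound 1 ?_
      filter_upwards [Metric.closedBall_mem_nhds (0 : ℝ) one_pos] with x hx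
      rw [mem_closedBall_zero_iff, Real.norm_eq_abs] at hx
      have := Real.exp_bound hx (n := 3) (by norm_num)
      simp only [Finset.sum_range_succ, Finset.range_zero, Finset.sum_empty, Nat.factorial] at this
      rw [Real.norm_eq_abs, norm_pow, Real.norm_eq_abs, one_mul]
      have h4 : 0 ≤ |x| ^ 3 := by positivity
      norm_num at this
      rw [show Real.exp x - 1 - x - x ^ 2 / 2 = Real.exp x - (1 + x + x ^ 2 / 2) by ring]
      linarith
    exact this.trans_isLittleO (isLittleO_pow_pow (by norm_num))
  have h4 : (fun ε => Real.exp (t ε) - 1 - t ε - t ε ^ 2 / 2) =o[𝓝[>] 0] fun ε => ε ^ 2 := by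
    refine (h3.comp_tendsto h2).trans_isBigO ?_
    refine IsBigO.pow ?_ 2
    have : (fun ε => ε * (p + ε * r ε)) =O[𝓝[>] 0] fun ε => ε * (1 : ℝ) :=
      (isBigO_refl _ _).mul (h1.isBigO_one ℝ)
    refine (this.congr' ?_ (Eventually.of_forall fun ε => mul_one ε))
    filter_upwards [self_mem_nhdsWithin] with ε h
    rw [ht ε h]; ring
  have h5 := (h4.tendsto_div_nhds_zero.add ((h1.pow 2).div_const 2)).add hr
  rw [zero_add] at h5
  refine h5.congr' ?_
  filter_upwards [self_mem_nhdsWithin] with ε h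
  have h6 : (ε : ℝ) ≠ 0 := ne_of_gt h
  rw [ht ε h]
  field_simp
  ring

/-! ### Moments of a perturbed Gaussian weight -/

/-- Dominated convergence for the second-order remainder of `p g₀ exp t`, cut off to the ball of
radius `δ / ε`. Outside of the ball the factor `ε⁻²` is at most `‖z‖² / δ²`. -/
theorem tendsto_integral_rescaled_remainder {δ lam K : ℝ} {g₀ p P₁ L₂ : Coord d → ℝ}
    {t : ℝ → Coord d → ℝ} (hδ : 0 < δ) (hlam : 0 < lam)
    (hg₀ : ∀ z, |g₀ z| ≤ K * Real.exp (-lam * ‖z‖ ^ 2)) (hg₀m : Measurable g₀)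
    (ht : Expands δ t (fun _ => 0) P₁ L₂) (htm : ∀ ε, 0 < ε → Measurable (t ε))
    (hP₁ : Measurable P₁) (hp : PolyBdd p) (hpm : Measurable p)
    (hg : ∀ ε z, 0 < ε → ε ≤ 1 → ε * ‖z‖ ≤ δ →
      |g₀ z| * Real.exp (t ε z) ≤ K * Real.exp (-lam * ‖z‖ ^ 2)) :
    Tendsto (fun ε => ∫ z, p z * g₀ z *
        (({z | ε * ‖z‖ ≤ δ}.indicator (fun z => Real.exp (t ε z)) z - 1 - ε * P₁ z) / ε ^ 2))
      (𝓝[>] 0) (𝓝 (∫ z, p z * g₀ z * (P₁ z ^ 2 / 2 + L₂ z))) := by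
  obtain ⟨r, K₁, N₁, hK₁, -, h1, hr, he, hl⟩ := ht
  obtain ⟨K₂, N₂, hK₂, hp⟩ := hp
  have hK : 0 ≤ K := by
    have := (abs_nonneg _).trans (hg₀ 0)
    exact nonneg_of_mul_nonneg_left this (Real.exp_pos _)
  set G : Coord d → ℝ := fun z => K * Real.exp (-lam * ‖z‖ ^ 2) with hG
  have hG0 : ∀ z, 0 ≤ G z := fun z => by positivity
  set X : Coord d → ℝ := fun z => 1 + ‖z‖ with hX
  have hX1 : ∀ z, 1 ≤ X z := one_le_one_add_norm
  have hms : ∀ ε : ℝ, MeasurableSet {z : Coord d | ε * ‖z‖ ≤ δ} := fun ε =>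
    measurableSet_le (by fun_prop) (by fun_prop)
  -- the dominating function: a polynomial times a Gaussian
  set c : ℝ := (8 * K₁ ^ 2 + K₁) + (1 + K₁) / δ ^ 2 with hc
  have hc0 : 0 ≤ c := by positivity
  refine tendsto_integral_filter_of_dominated_convergence
    (fun z => K₂ * K * c * (X z ^ (N₂ + (2 * N₁ + 2)) * Real.exp (-lam * ‖z‖ ^ 2))) ?_ ?_
    ((integrable_pow_mul_exp_neg_sq hlam _).const_mul _) ?_
  · filter_upwards [self_mem_nhdsWithin] with ε hε
    have := htm ε hε
    refine Measurable.aestronglyMeasurable ?_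
    refine (hpm.mul hg₀m).mul ((((Measurable.indicator (by fun_prop) (hms ε)).sub_const 1).sub
      (hP₁.const_mul ε)).div_const _)
  · filter_upwards [Ioc_mem_nhdsGT one_pos] with ε hε
    refine ae_of_all _ fun z => ?_
    have key : |g₀ z| * |({z | ε * ‖z‖ ≤ δ}.indicator (fun z => Real.exp (t ε z)) z - 1 - ε * P₁ z)
        / ε ^ 2| ≤ c * X z ^ (2 * N₁ + 2) * G z := by
      have hε2 : 0 < ε ^ 2 := pow_pos hε.1 2
      have e0 : X z ^ N₁ ≤ X z ^ (2 * N₁ + 2) := pow_le_pow_right₀ (hX1 z) (by omega)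
      have e1 : (X z ^ N₁) ^ 2 ≤ X z ^ (2 * N₁ + 2) := by
        rw [← pow_mul]
        exact pow_le_pow_right₀ (hX1 z) (by omega)
      have hX0 : 0 ≤ X z ^ N₁ := by have := hX1 z; positivity
      rw [abs_div, abs_of_pos hε2, mul_div_assoc', div_le_iff₀ hε2]
      by_cases hz : ε * ‖z‖ ≤ δ
      · rw [Set.indicator_of_mem (by exact hz)]
        have e2 := hr ε z hε.1 hε.2 hz
        have e3 : t ε z = ε * P₁ z + ε ^ 2 * r ε z := by simpa using he ε z hε.1
        have e4 : |t ε z| ≤ ε * (2 * (K₁ * X z ^ N₁)) := by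
          rw [e3]
          refine (abs_add_le _ _).trans ?_
          rw [abs_mul, abs_mul, abs_of_pos hε.1, abs_of_pos hε2]
          have : ε ^ 2 * |r ε z| ≤ ε * |r ε z| := by
            gcongr
            exact pow_le_of_le_one hε.1.le hε.2 two_ne_zero
          have e5 := mul_le_mul_of_nonneg_left e2 hε.1.le
          have e6 := mul_le_mul_of_nonneg_left (h1 z) hε.1.le
          simp only [hX] at *
          linarith
        have e5 : t ε z ^ 2 ≤ ε ^ 2 * (4 * K₁ ^ 2 * X z ^ (2 * N₁ + 2)) := by
          rw [← sq_abs]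
          calc |t ε z| ^ 2 ≤ (ε * (2 * (K₁ * X z ^ N₁))) ^ 2 := by gcongr
            _ = ε ^ 2 * (4 * K₁ ^ 2 * (X z ^ N₁) ^ 2) := by ring
            _ ≤ _ := by gcongr
        have e6 : |Real.exp (t ε z) - 1 - ε * P₁ z| ≤
            ε ^ 2 * (4 * K₁ ^ 2 * X z ^ (2 * N₁ + 2)) * (1 + Real.exp (t ε z)) +
              ε ^ 2 * (K₁ * X z ^ (2 * N₁ + 2)) := by
          have : Real.exp (t ε z) - 1 - ε * P₁ z =
              (Real.exp (t ε z) - 1 - t ε z) + ε ^ 2 * r ε z := by rw [e3]; ring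
          rw [this]
          refine (abs_add_le _ _).trans (add_le_add ?_ ?_)
          · exact (abs_exp_sub_one_sub_le _).trans (by gcongr)
          · rw [abs_mul, abs_of_pos hε2]
            gcongr
            exact e2.trans (by gcongr)
        calc |g₀ z| * |Real.exp (t ε z) - 1 - ε * P₁ z|
            ≤ |g₀ z| * (ε ^ 2 * (4 * K₁ ^ 2 * X z ^ (2 * N₁ + 2)) * (1 + Real.exp (t ε z)) +
              ε ^ 2 * (K₁ * X z ^ (2 * N₁ + 2))) := by gcongr
          _ = ε ^ 2 * X z ^ (2 * N₁ + 2) * (4 * K₁ ^ 2 * (|g₀ z| + |g₀ z| * Real.exp (t ε z))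
                + K₁ * |g₀ z|) := by ring
          _ ≤ ε ^ 2 * X z ^ (2 * N₁ + 2) * (4 * K₁ ^ 2 * (G z + G z) + K₁ * G z) := by
              have := hX1 z
              gcongr
              · exact hg₀ z
              · exact hg ε z hε.1 hε.2 hz
              · exact hg₀ z
          _ = (8 * K₁ ^ 2 + K₁) * X z ^ (2 * N₁ + 2) * G z * ε ^ 2 := by ring
          _ ≤ c * X z ^ (2 * N₁ + 2) * G z * ε ^ 2 := by
              have := hX1 z
              have := hG0 z
              gcongr
              rw [hc]
              have : 0 ≤ (1 + K₁) / δ ^ 2 := by positivity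
              linarith
      · rw [Set.indicator_of_notMem (by exact hz), zero_sub]
        have e2 : 1 ≤ X z ^ 2 / δ ^ 2 * ε ^ 2 := by
          rw [div_mul_eq_mul_div, one_le_div (by positivity), ← mul_pow]
          have : δ ≤ X z * ε := by
            have h3 : δ < ε * ‖z‖ := not_le.1 hz
            have h4 : ε * ‖z‖ ≤ X z * ε := by
              rw [mul_comm]
              have := hε.1
              gcongr
              simp [hX]
            linarith
          gcongr
        have e3 : |-1 - ε * P₁ z| ≤ (1 + K₁) * X z ^ (2 * N₁) := by
          have h3 : |ε * P₁ z| ≤ K₁ * X z ^ N₁ := by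
            rw [abs_mul, abs_of_pos hε.1]
            exact (mul_le_of_le_one_left (abs_nonneg _) hε.2).trans (h1 z)
          have h4 : X z ^ N₁ ≤ X z ^ (2 * N₁) := pow_le_pow_right₀ (hX1 z) (by omega)
          have h5 : 1 ≤ X z ^ (2 * N₁) := one_le_pow₀ (hX1 z)
          have h6 := abs_sub (-1) (ε * P₁ z)
          rw [abs_neg, abs_one] at h6
          have h7 := mul_le_mul_of_nonneg_left h4 hK₁
          linarith
        have := hX1 z
        have := hG0 z
        calc |g₀ z| * |-1 - ε * P₁ z| ≤ G z * ((1 + K₁) * X z ^ (2 * N₁)) := by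
              gcongr
              exact hg₀ z
          _ ≤ G z * ((1 + K₁) * X z ^ (2 * N₁)) * (X z ^ 2 / δ ^ 2 * ε ^ 2) :=
              le_mul_of_one_le_right (by positivity) e2
          _ = (1 + K₁) / δ ^ 2 * X z ^ (2 * N₁ + 2) * G z * ε ^ 2 := by rw [pow_add]; ring
          _ ≤ c * X z ^ (2 * N₁ + 2) * G z * ε ^ 2 := by
              gcongr
              rw [hc]
              have : 0 ≤ 8 * K₁ ^ 2 + K₁ := by positivity
              linarith
    rw [Real.norm_eq_abs, abs_mul, abs_mul, mul_assoc]
    calc _ ≤ K₂ * X z ^ N₂ * (c * X z ^ (2 * N₁ + 2) * G z) :=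
          mul_le_mul (hp z) key (by positivity) (by have := hX1 z; positivity)
      _ = _ := by rw [hG, pow_add]; ring
  · refine ae_of_all _ fun z => Tendsto.const_mul _ ?_
    have h2 := tendsto_exp_sub_one_sub_div (t := fun ε => t ε z) (p := P₁ z) (r := fun ε => r ε z)
      (fun ε h => by simpa using he ε z h) (hl z)
    refine h2.congr' ?_
    have h3 : Tendsto (fun ε : ℝ => ε * ‖z‖) (𝓝[>] 0) (𝓝 0) := by
      have : Tendsto (fun ε : ℝ => ε * ‖z‖) (𝓝 0) (𝓝 (0 * ‖z‖)) :=
        (continuous_id.mul continuous_const).tendsto 0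
      rw [zero_mul] at this
      exact this.mono_left nhdsWithin_le_nhds
    filter_upwards [h3.eventually (ge_mem_nhds hδ)] with ε hε
    rw [Set.indicator_of_mem (by exact hε)]

theorem evalAt_mul (z : Coord d) (p q : MvPolynomial (Fin d) ℝ) :
    evalAt z (p * q) = evalAt z p * evalAt z q := by
  simp [evalAt]

/-- Second-order expansion of the polynomial moments of a perturbed Gaussian weight, restricted to
a ball of radius `δ / ε`. -/
theorem isLittleO_setIntegral_expansion {δ lam lam' K s : ℝ} {A : Matrix (Fin d) (Fin d) ℝ}
    (hlam' : 0 < lam') (hA : ∀ z : Coord d, lam' * ‖z‖ ^ 2 ≤ quadForm A z)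
    {t : ℝ → Coord d → ℝ} {L₂ : Coord d → ℝ} {p₁ p₂ : MvPolynomial (Fin d) ℝ}
    (hδ : 0 < δ) (hlam : 0 < lam)
    (ht : Expands δ t (fun _ => 0) (fun z => evalAt z p₁) L₂)
    (hp₂ : ∀ z, evalAt z p₁ ^ 2 / 2 + L₂ z = evalAt z p₂)
    (htm : ∀ ε, 0 < ε → Measurable (t ε))
    (hg : ∀ ε z, 0 < ε → ε ≤ 1 → ε * ‖z‖ ≤ δ →
      gaussWeight s A z * Real.exp (t ε z) ≤ K * Real.exp (-lam * ‖z‖ ^ 2))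
    (p : MvPolynomial (Fin d) ℝ) :
    (fun ε => (∫ z in {z | ε * ‖z‖ ≤ δ}, evalAt z p * (gaussWeight s A z * Real.exp (t ε z)))
      - (gaussFunctional s A hlam' hA p + ε * gaussFunctional s A hlam' hA (p * p₁)
        + ε ^ 2 * gaussFunctional s A hlam' hA (p * p₂))) =o[𝓝[>] 0] fun ε => ε ^ 2 := by
  set μ := min lam (lam' / 4) with hμ
  have hμ0 : 0 < μ := lt_min hlam (by positivity)
  have hpos : ∀ z, |gaussWeight s A z| = gaussWeight s A z := fun z => abs_of_pos (Real.exp_pos _)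
  have b1 : ∀ z, |gaussWeight s A z| ≤ (|K| + Real.exp s) * Real.exp (-μ * ‖z‖ ^ 2) := by
    intro z
    refine (gaussWeight_le hA z).trans ?_
    gcongr
    · linarith [abs_nonneg K]
    · exact min_le_right _ _
  have b2 : ∀ ε z, 0 < ε → ε ≤ 1 → ε * ‖z‖ ≤ δ →
      |gaussWeight s A z| * Real.exp (t ε z) ≤ (|K| + Real.exp s) * Real.exp (-μ * ‖z‖ ^ 2) := by
    intro ε z h1 h2 h3
    rw [hpos]
    refine (hg ε z h1 h2 h3).trans ?_
    gcongr
    · linarith [le_abs_self K, Real.exp_pos s]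
    · exact min_le_left _ _
  have hpm : ∀ q, Measurable fun z : Coord d => evalAt z q :=
    fun q => (continuous_evalAt q).measurable
  have hgm : Measurable (gaussWeight s A) := (continuous_gaussWeight s A).measurable
  have key := tendsto_integral_rescaled_remainder hδ hμ0 b1 hgm ht htm (hpm p₁) (polyBdd_evalAt p)
    (hpm p) b2
  have hlim : ∫ z, evalAt z p * gaussWeight s A z * (evalAt z p₁ ^ 2 / 2 + L₂ z) =
      gaussFunctional s A hlam' hA (p * p₂) :=
    integral_congr_ae (ae_of_all _ fun z => by
      simp only [hp₂, evalAt_mul]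
      ring)
  rw [hlim] at key
  have hi := integrable_evalAt_mul_gaussWeight (s := s) hlam' hA
  have hms : ∀ ε : ℝ, MeasurableSet {z : Coord d | ε * ‖z‖ ≤ δ} := fun ε =>
    measurableSet_le (by fun_prop) (by fun_prop)
  rw [isLittleO_iff_tendsto' (by
    filter_upwards [self_mem_nhdsWithin] with ε (hε : 0 < ε) h
    exact absurd h (by positivity))]
  have key2 := key.sub_const (gaussFunctional s A hlam' hA (p * p₂))
  rw [sub_self] at key2
  refine key2.congr' ?_
  filter_upwards [Ioc_mem_nhdsGT one_pos] with ε hε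
  have hε0 : ε ≠ 0 := hε.1.ne'
  have hI : Integrable fun z : Coord d => {z | ε * ‖z‖ ≤ δ}.indicator
      (fun z => evalAt z p * (gaussWeight s A z * Real.exp (t ε z))) z := by
    obtain ⟨K', N, hK', hp'⟩ := polyBdd_evalAt p
    have := htm ε hε.1
    refine ((integrable_pow_mul_exp_neg_sq hμ0 N).const_mul (K' * (|K| + Real.exp s))).mono'
      (((hpm p).mul (hgm.mul (by fun_prop))).indicator (hms ε)).aestronglyMeasurable
      (ae_of_all _ fun z => ?_)
    by_cases hz : ε * ‖z‖ ≤ δ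
    · rw [Set.indicator_of_mem (by exact hz), Real.norm_eq_abs, abs_mul, abs_mul, Real.abs_exp,
        mul_mul_mul_comm]
      exact mul_le_mul (hp' z) (b2 ε z hε.1 hε.2 hz) (by positivity) (by positivity)
    · rw [Set.indicator_of_notMem (by exact hz), norm_zero]
      positivity
  have hsplit : ∫ z, evalAt z p * gaussWeight s A z *
        (({z | ε * ‖z‖ ≤ δ}.indicator (fun z => Real.exp (t ε z)) z - 1 - ε * evalAt z p₁) / ε ^ 2)
      = ((∫ z in {z | ε * ‖z‖ ≤ δ}, evalAt z p * (gaussWeight s A z * Real.exp (t ε z)))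
        - gaussFunctional s A hlam' hA p - ε * gaussFunctional s A hlam' hA (p * p₁)) / ε ^ 2 := by
    have e : ∀ z : Coord d, evalAt z p * gaussWeight s A z *
        (({z | ε * ‖z‖ ≤ δ}.indicator (fun z => Real.exp (t ε z)) z - 1 - ε * evalAt z p₁) / ε ^ 2)
        = ({z | ε * ‖z‖ ≤ δ}.indicator
            (fun z => evalAt z p * (gaussWeight s A z * Real.exp (t ε z))) z
          - evalAt z p * gaussWeight s A z - ε * (evalAt z (p * p₁) * gaussWeight s A z))
          / ε ^ 2 := by
      intro z
      rw [evalAt_mul]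
      by_cases hz : ε * ‖z‖ ≤ δ
      · rw [Set.indicator_of_mem (by exact hz), Set.indicator_of_mem (by exact hz)]
        ring
      · rw [Set.indicator_of_notMem (by exact hz), Set.indicator_of_notMem (by exact hz)]
        ring
    have hs : Integrable fun z : Coord d => {z | ε * ‖z‖ ≤ δ}.indicator
        (fun z => evalAt z p * (gaussWeight s A z * Real.exp (t ε z))) z
          - evalAt z p * gaussWeight s A z := hI.sub (hi p)
    simp only [e]
    rw [integral_div, integral_sub hs ((hi (p * p₁)).const_mul ε), integral_sub hI (hi p),
      integral_const_mul, integral_indicator (hms ε)]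
    rfl
  rw [hsplit]
  field_simp
  ring

/-! ### Taylor expansions of the inverse and the logarithmic determinant -/

/-- Taylor's theorem of order two with Peano remainder. -/
theorem isLittleO_taylor_two {f : Coord d → ℝ} (hf : ContDiff ℝ 2 f) :
    (fun h => f h - f 0 - fderiv ℝ f 0 h - fderiv ℝ (fderiv ℝ f) 0 h h / 2)
      =o[𝓝 0] fun h => ‖h‖ ^ 2 := by
  have hf1 : Differentiable ℝ f := hf.differentiable two_ne_zero
  have hf2 : ContDiff ℝ 1 (fderiv ℝ f) := hf.fderiv_right (by norm_num)
  have h2 : HasFDerivAt (fderiv ℝ f) (fderiv ℝ (fderiv ℝ f) 0) 0 :=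
    (hf2.differentiable one_ne_zero 0).hasFDerivAt
  rw [isLittleO_iff]
  intro c hc
  have h3 := h2.isLittleO.bound hc
  obtain ⟨η, hη, hb⟩ := Metric.eventually_nhds_iff_ball.1 h3
  filter_upwards [Metric.ball_mem_nhds (0 : Coord d) hη] with h hh
  -- apply the mean value inequality to the Taylor remainder on the segment from `0` to `h`
  have hd : ∀ s ∈ Set.Icc (0 : ℝ) 1, HasDerivWithinAt
      (fun s : ℝ => f (s • h) - s * fderiv ℝ f 0 h - s ^ 2 / 2 * fderiv ℝ (fderiv ℝ f) 0 h h)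
      (fderiv ℝ f (s • h) h - fderiv ℝ f 0 h - s * fderiv ℝ (fderiv ℝ f) 0 h h)
      (Set.Icc 0 1) s := by
    intro s _
    have e1 : HasDerivAt (fun s : ℝ => f (s • h)) (fderiv ℝ f (s • h) h) s := by
      have e0 : HasDerivAt (fun s : ℝ => s • h) h s := by
        simpa using (hasDerivAt_id s).smul_const h
      exact (hf1 (s • h)).hasFDerivAt.comp_hasDerivAt s e0
    have e2 := ((hasDerivAt_id s).mul_const (fderiv ℝ f 0 h))
    have e3 := (((hasDerivAt_id s).pow 2).div_const 2).mul_const (fderiv ℝ (fderiv ℝ f) 0 h h)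
    refine (((e1.sub e2).sub e3).congr_deriv ?_).hasDerivWithinAt
    simp
  have hbd : ∀ s ∈ Set.Ico (0 : ℝ) 1,
      ‖fderiv ℝ f (s • h) h - fderiv ℝ f 0 h - s * fderiv ℝ (fderiv ℝ f) 0 h h‖
        ≤ c * ‖h‖ ^ 2 := by
    intro s hs
    have hsn : ‖s • h‖ ≤ ‖h‖ := by
      rw [norm_smul, Real.norm_of_nonneg hs.1]
      exact mul_le_of_le_one_left (norm_nonneg _) hs.2.le
    have e1 := hb (s • h) (by
      rw [mem_ball_zero_iff] at hh ⊢
      exact hsn.trans_lt hh)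
    rw [sub_zero] at e1
    have e2 : fderiv ℝ f (s • h) h - fderiv ℝ f 0 h - s * fderiv ℝ (fderiv ℝ f) 0 h h =
        (fderiv ℝ f (s • h) - fderiv ℝ f 0 - fderiv ℝ (fderiv ℝ f) 0 (s • h)) h := by
      simp
    rw [e2]
    calc _ ≤ ‖fderiv ℝ f (s • h) - fderiv ℝ f 0 - fderiv ℝ (fderiv ℝ f) 0 (s • h)‖ * ‖h‖ :=
          ContinuousLinearMap.le_opNorm _ _
      _ ≤ c * ‖h‖ * ‖h‖ := by
          gcongr
          exact e1.trans (by gcongr)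
      _ = c * ‖h‖ ^ 2 := by ring
  have := norm_image_sub_le_of_norm_deriv_le_segment_01' hd hbd
  simp only [one_smul, zero_smul] at this
  rw [Real.norm_of_nonneg (by positivity : (0 : ℝ) ≤ ‖h‖ ^ 2)]
  refine le_trans (le_of_eq ?_) this
  congr 1
  ring

theorem isLittleO_taylor_one {f : Coord d → ℝ} (hf : ContDiff ℝ 1 f) :
    (fun h => f h - f 0 - fderiv ℝ f 0 h) =o[𝓝 0] fun h => ‖h‖ := by
  have h1 : HasFDerivAt f (fderiv ℝ f 0) 0 := (hf.differentiable one_ne_zero 0).hasFDerivAt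
  simpa using h1.isLittleO.norm_right

theorem fderiv_fderiv_apply {f : Coord d → ℝ} (hf : ContDiff ℝ 2 f) (x z w : Coord d) :
    fderiv ℝ (fderiv ℝ f) x w z = fderiv ℝ (fun y => fderiv ℝ f y z) x w := by
  have hf2 : ContDiff ℝ 1 (fderiv ℝ f) := hf.fderiv_right (by norm_num)
  rw [fderiv_clm_apply (hf2.differentiable one_ne_zero x) (differentiableAt_const z)]
  simp

/-- The entrywise directional derivative `∂_z M` of a matrix field. -/
def dirDeriv (M : Coord d → Matrix (Fin d) (Fin d) ℝ) (z x : Coord d) :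
    Matrix (Fin d) (Fin d) ℝ :=
  Matrix.of fun i j => fderiv ℝ (fun y => M y i j) x z

theorem dirDeriv_mul {M N : Coord d → Matrix (Fin d) (Fin d) ℝ} {x : Coord d}
    (hM : ∀ i j, DifferentiableAt ℝ (fun y => M y i j) x)
    (hN : ∀ i j, DifferentiableAt ℝ (fun y => N y i j) x) (z : Coord d) :
    dirDeriv (fun y => M y * N y) z x = dirDeriv M z x * N x + M x * dirDeriv N z x := by
  ext i j
  simp only [dirDeriv, Matrix.mul_apply, Matrix.of_apply, Matrix.add_apply]
  have h1 : HasFDerivAt (fun y => ∑ k, M y i k * N y k j) (∑ k, (M x i k •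
      fderiv ℝ (fun y => N y k j) x + N x k j • fderiv ℝ (fun y => M y i k) x)) x :=
    HasFDerivAt.fun_sum fun k _ => (hM i k).hasFDerivAt.mul (hN k j).hasFDerivAt
  rw [h1.fderiv]
  simp only [sum_apply, add_apply, smul_apply, smul_eq_mul]
  rw [← Finset.sum_add_distrib]
  exact Finset.sum_congr rfl fun k _ => by ring

theorem dirDeriv_neg (M : Coord d → Matrix (Fin d) (Fin d) ℝ) (z x : Coord d) :
    dirDeriv (fun y => -M y) z x = -dirDeriv M z x := by
  ext i j
  simp [dirDeriv, fderiv_fun_neg]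

theorem contDiff_mul_entry {n : WithTop ℕ∞} {M N : Coord d → Matrix (Fin d) (Fin d) ℝ}
    (hM : ∀ i j, ContDiff ℝ n fun y => M y i j) (hN : ∀ i j, ContDiff ℝ n fun y => N y i j)
    (i j : Fin d) : ContDiff ℝ n fun y => (M y * N y) i j := by
  simp only [Matrix.mul_apply]
  exact ContDiff.sum fun k _ => (hM i k).mul (hN k j)

theorem contDiff_dirDeriv {M : Coord d → Matrix (Fin d) (Fin d) ℝ}
    (hM : ∀ i j, ContDiff ℝ 2 fun y => M y i j) (z : Coord d) (i j : Fin d) :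
    ContDiff ℝ 1 fun y => dirDeriv M z y i j :=
  ((hM i j).fderiv_right (by norm_num)).clm_apply contDiff_const

theorem contDiff_det {n : WithTop ℕ∞} {M : Coord d → Matrix (Fin d) (Fin d) ℝ}
    (hM : ∀ i j, ContDiff ℝ n fun y => M y i j) : ContDiff ℝ n fun y => (M y).det := by
  simp only [Matrix.det_apply']
  exact ContDiff.sum fun σ _ => contDiff_const.mul (contDiff_prod fun i _ => hM _ _)

theorem contDiff_inv_entry {n : WithTop ℕ∞} {M : Coord d → Matrix (Fin d) (Fin d) ℝ}
    (hM : ∀ i j, ContDiff ℝ n fun y => M y i j) (hdet : ∀ y, (M y).det ≠ 0) (i j : Fin d) :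
    ContDiff ℝ n fun y => (M y)⁻¹ i j := by
  simp only [Matrix.inv_def, Matrix.smul_apply, Ring.inverse_eq_inv', smul_eq_mul,
    Matrix.adjugate_apply]
  refine ((contDiff_det hM).inv hdet).mul (contDiff_det fun k l => ?_)
  by_cases hk : k = j
  · subst hk
    simp only [Matrix.updateRow_self]
    exact contDiff_const
  · simp only [Matrix.updateRow_ne hk]
    exact hM k l

/-- Jacobi's formula for the derivative of a determinant. -/
theorem fderiv_det {M : Coord d → Matrix (Fin d) (Fin d) ℝ} {x : Coord d}
    (hM : ∀ i j, DifferentiableAt ℝ (fun y => M y i j) x) (z : Coord d) :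
    fderiv ℝ (fun y => (M y).det) x z = ((M x).adjugate * dirDeriv M z x).trace := by
  classical
  have h1 : HasFDerivAt (fun y => (M y).det) (∑ σ : Equiv.Perm (Fin d),
      ((Equiv.Perm.sign σ : ℤ) : ℝ) • ∑ i, (∏ j ∈ Finset.univ.erase i, M x (σ j) j) •
        fderiv ℝ (fun y => M y (σ i) i) x) x := by
    simp only [Matrix.det_apply']
    refine HasFDerivAt.fun_sum fun σ _ => HasFDerivAt.const_mul ?_ _
    exact HasFDerivAt.finsetProd fun i _ => (hM (σ i) i).hasFDerivAt
  have h2 : ∀ i, ((M x).adjugate * dirDeriv M z x) i i =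
      ((M x).updateCol i fun k => dirDeriv M z x k i).det := by
    intro i
    rw [← Matrix.cramer_apply, Matrix.cramer_eq_adjugate_mulVec]
    rfl
  rw [h1.fderiv, Matrix.trace]
  simp only [Matrix.diag_apply, h2, Matrix.det_apply', sum_apply, smul_apply, smul_eq_mul]
  rw [Finset.sum_comm]
  refine Finset.sum_congr rfl fun σ _ => ?_
  rw [Finset.mul_sum]
  refine Finset.sum_congr rfl fun i _ => ?_
  rw [← Finset.mul_prod_erase _ _ (Finset.mem_univ i), Matrix.updateCol_self, mul_comm (∏ j ∈ _, _)]
  congr 2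
  refine Finset.prod_congr rfl fun j hj => ?_
  rw [Matrix.updateCol_ne (Finset.ne_of_mem_erase hj)]

section Inverse

variable {M : Coord d → Matrix (Fin d) (Fin d) ℝ}

/-- Differentiate `M M⁻¹ = 1`. -/
theorem dirDeriv_inv (hM : ∀ i j, ContDiff ℝ 2 fun y => M y i j) (hdet : ∀ y, 0 < (M y).det)
    (z x : Coord d) :
    dirDeriv (fun y => (M y)⁻¹) z x = -((M x)⁻¹ * dirDeriv M z x * (M x)⁻¹) := by
  have hu : ∀ y, IsUnit (M y).det := fun y => (hdet y).ne'.isUnit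
  have h1 := dirDeriv_mul (x := x) (fun i j => (hM i j).differentiable two_ne_zero x)
    (fun i j => (contDiff_inv_entry hM (fun y => (hdet y).ne') i j).differentiable two_ne_zero x) z
  have h2 : dirDeriv (fun y => M y * (M y)⁻¹) z x = 0 := by
    simp only [Matrix.mul_nonsing_inv _ (hu _)]
    ext i j
    simp [dirDeriv]
  rw [h2] at h1
  have h3 : M x * dirDeriv (fun y => (M y)⁻¹) z x = -(dirDeriv M z x * (M x)⁻¹) :=
    (neg_eq_of_add_eq_zero_right h1.symm).symm
  calc _ = (M x)⁻¹ * (M x * dirDeriv (fun y => (M y)⁻¹) z x) := by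
        rw [← Matrix.mul_assoc, Matrix.nonsing_inv_mul _ (hu x), Matrix.one_mul]
    _ = _ := by rw [h3, Matrix.mul_neg, Matrix.mul_assoc]

theorem dirDeriv_dirDeriv_inv (hM : ∀ i j, ContDiff ℝ 2 fun y => M y i j)
    (hdet : ∀ y, 0 < (M y).det) (z x : Coord d) :
    dirDeriv (dirDeriv (fun y => (M y)⁻¹) z) z x =
      (2 : ℝ) • ((M x)⁻¹ * dirDeriv M z x * (M x)⁻¹ * dirDeriv M z x * (M x)⁻¹)
        - (M x)⁻¹ * dirDeriv (dirDeriv M z) z x * (M x)⁻¹ := by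
  have hT : ∀ i j, ContDiff ℝ 1 fun y => (M y)⁻¹ i j := fun i j =>
    (contDiff_inv_entry hM (fun y => (hdet y).ne') i j).of_le (by norm_num)
  have hM' := contDiff_dirDeriv hM z
  have e : dirDeriv (fun y => (M y)⁻¹) z = fun y => -((M y)⁻¹ * dirDeriv M z y * (M y)⁻¹) :=
    funext fun y => dirDeriv_inv hM hdet z y
  rw [e, dirDeriv_neg, dirDeriv_mul (M := fun y => (M y)⁻¹ * dirDeriv M z y)
    (fun i j => (contDiff_mul_entry hT hM' i j).differentiable one_ne_zero x)
    (fun i j => (hT i j).differentiable one_ne_zero x),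
    dirDeriv_mul (fun i j => (hT i j).differentiable one_ne_zero x)
    (fun i j => (hM' i j).differentiable one_ne_zero x), dirDeriv_inv hM hdet, two_smul]
  noncomm_ring

/-- `-½ log det M`, the logarithm of the normalization of a Gaussian with covariance `2 M`. -/
def halfLogDet (M : Coord d → Matrix (Fin d) (Fin d) ℝ) (x : Coord d) : ℝ :=
  -(Real.log (M x).det) / 2

theorem contDiff_halfLogDet (hM : ∀ i j, ContDiff ℝ 2 fun y => M y i j)
    (hdet : ∀ y, 0 < (M y).det) : ContDiff ℝ 2 (halfLogDet M) :=
  ((contDiff_det hM).log fun y => (hdet y).ne').neg.div_const 2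

theorem fderiv_halfLogDet (hM : ∀ i j, ContDiff ℝ 2 fun y => M y i j)
    (hdet : ∀ y, 0 < (M y).det) (z x : Coord d) :
    fderiv ℝ (halfLogDet M) x z = -((M x)⁻¹ * dirDeriv M z x).trace / 2 := by
  have hd : DifferentiableAt ℝ (fun y => (M y).det) x :=
    (contDiff_det hM).differentiable two_ne_zero x
  have h1 : HasFDerivAt (fun y => -(Real.log (M y).det) * (1 / 2)) _ x :=
    (hd.hasFDerivAt.log (hdet x).ne').fun_neg.mul_const (1 / 2)
  have h2 : halfLogDet M = fun y => -(Real.log (M y).det) * (1 / 2) := by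
    ext y; rw [halfLogDet]; ring
  rw [h2, HasFDerivAt.fderiv h1]
  simp only [smul_apply, neg_apply, smul_eq_mul,
    fderiv_det (fun i j => (hM i j).differentiable two_ne_zero x), Matrix.inv_def,
    Ring.inverse_eq_inv', Matrix.smul_mul, Matrix.trace_smul]
  ring

theorem fderiv_fderiv_halfLogDet (hM : ∀ i j, ContDiff ℝ 2 fun y => M y i j)
    (hdet : ∀ y, 0 < (M y).det) (z x : Coord d) :
    fderiv ℝ (fderiv ℝ (halfLogDet M)) x z z =
      ((M x)⁻¹ * dirDeriv M z x * (M x)⁻¹ * dirDeriv M z x).trace / 2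
        - ((M x)⁻¹ * dirDeriv (dirDeriv M z) z x).trace / 2 := by
  have hT : ∀ i j, ContDiff ℝ 1 fun y => (M y)⁻¹ i j := fun i j =>
    (contDiff_inv_entry hM (fun y => (hdet y).ne') i j).of_le (by norm_num)
  have hM' := contDiff_dirDeriv hM z
  rw [fderiv_fderiv_apply (contDiff_halfLogDet hM hdet)]
  simp only [fderiv_halfLogDet hM hdet]
  have h1 : fderiv ℝ (fun y => -((M y)⁻¹ * dirDeriv M z y).trace / 2) x z =
      -(dirDeriv (fun y => (M y)⁻¹ * dirDeriv M z y) z x).trace / 2 := by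
    have hd : ∀ i, DifferentiableAt ℝ (fun y => ((M y)⁻¹ * dirDeriv M z y) i i) x := fun i =>
      (contDiff_mul_entry hT hM' i i).differentiable one_ne_zero x
    have h2 : HasFDerivAt (fun y => -(∑ i, ((M y)⁻¹ * dirDeriv M z y) i i) * (1 / 2)) _ x :=
      (HasFDerivAt.fun_sum fun i _ => (hd i).hasFDerivAt).fun_neg.mul_const (1 / 2)
    have h3 : (fun y => -((M y)⁻¹ * dirDeriv M z y).trace / 2) =
        fun y => -(∑ i, ((M y)⁻¹ * dirDeriv M z y) i i) * (1 / 2) := by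
      ext y; rw [Matrix.trace]; simp only [Matrix.diag_apply]; ring
    rw [h3, HasFDerivAt.fderiv h2]
    simp only [smul_apply, neg_apply, sum_apply, smul_eq_mul, Matrix.trace, Matrix.diag_apply,
      dirDeriv, Matrix.of_apply]
    ring
  rw [h1, dirDeriv_mul (fun i j => (hT i j).differentiable one_ne_zero x)
    (fun i j => (hM' i j).differentiable one_ne_zero x), dirDeriv_inv hM hdet, Matrix.trace_add,
    Matrix.neg_mul, Matrix.trace_neg]
  ring

end Inverse

/-! ### Expansion of the kernel exponent -/

open Matrix in
theorem quadForm_eq (A : Matrix (Fin d) (Fin d) ℝ) (z : Fin d → ℝ) :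
    quadForm A z = z ⬝ᵥ A *ᵥ z := by
  rw [dotProduct_mulVec_eq_sum, quadForm]
  exact Finset.sum_congr rfl fun i _ => Finset.sum_congr rfl fun j _ => by ring

open Matrix in
theorem quadForm_nonneg_of_posDef {A : Matrix (Fin d) (Fin d) ℝ} (hA : A.PosDef) (z : Fin d → ℝ) :
    0 ≤ quadForm A z := by
  have := hA.posSemidef.dotProduct_mulVec_nonneg z
  rwa [star_trivial, ← quadForm_eq] at this

open Matrix in
theorem isSymm_of_posDef {A : Matrix (Fin d) (Fin d) ℝ} (hA : A.PosDef) : A.IsSymm := by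
  have := hA.isHermitian.eq
  rwa [conjTranspose_eq_transpose_of_trivial] at this

open Matrix in
/-- The Cauchy-Schwarz inequality for a positive definite form and its inverse. -/
theorem dotProduct_sq_le {A : Matrix (Fin d) (Fin d) ℝ} (hA : A.PosDef) (u x : Fin d → ℝ) :
    (u ⬝ᵥ x) ^ 2 ≤ quadForm A⁻¹ u * quadForm A x := by
  have hu : IsUnit A.det := hA.det_pos.ne'.isUnit
  have h1 : A *ᵥ (A⁻¹ *ᵥ u) = u := by rw [mulVec_mulVec, mul_nonsing_inv _ hu, one_mulVec]
  have h2 : (A⁻¹ *ᵥ u) ⬝ᵥ A *ᵥ x = u ⬝ᵥ x := by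
    rw [dotProduct_mulVec, ← mulVec_transpose, (isSymm_of_posDef hA).eq, h1]
  have key : ∀ s : ℝ, 0 ≤ quadForm A x * (s * s) + (-2 * (u ⬝ᵥ x)) * s + quadForm A⁻¹ u := by
    intro s
    have := quadForm_nonneg_of_posDef hA (A⁻¹ *ᵥ u - s • x)
    rw [quadForm_eq] at this
    simp only [mulVec_sub, mulVec_smul, sub_dotProduct, dotProduct_sub, smul_dotProduct,
      dotProduct_smul, h1, h2, smul_eq_mul] at this
    rw [quadForm_eq, quadForm_eq]
    have e1 : (A⁻¹ *ᵥ u) ⬝ᵥ u = u ⬝ᵥ A⁻¹ *ᵥ u := dotProduct_comm _ _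
    have e2 : x ⬝ᵥ u = u ⬝ᵥ x := dotProduct_comm _ _
    rw [e1, e2] at this
    linarith
  have := discrim_le_zero key
  rw [discrim] at this
  nlinarith

theorem quadForm_le {A : Matrix (Fin d) (Fin d) ℝ} {m : ℝ} (hA : ∀ i j, |A i j| ≤ m)
    (z : Coord d) : quadForm A z ≤ (d : ℝ) ^ 2 * m * ‖z‖ ^ 2 := by
  have : ∀ i j, z i * A i j * z j ≤ m * ‖z‖ ^ 2 := by
    intro i j
    refine (le_abs_self _).trans ?_
    rw [abs_mul, abs_mul]
    calc |z i| * |A i j| * |z j| ≤ ‖z‖ * m * ‖z‖ := by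
          have h0 : 0 ≤ m := (abs_nonneg _).trans (hA i j)
          gcongr
          · exact abs_apply_le_norm z i
          · exact hA i j
          · exact abs_apply_le_norm z j
      _ = _ := by ring
  calc quadForm A z ≤ ∑ i : Fin d, ∑ j : Fin d, m * ‖z‖ ^ 2 :=
        Finset.sum_le_sum fun i _ => Finset.sum_le_sum fun j _ => this i j
    _ = _ := by simp; ring

theorem dotProduct_self_eq_norm_sq (w : Coord d) : dotProduct (w : Fin d → ℝ) w = ‖w‖ ^ 2 := by
  rw [EuclideanSpace.real_norm_sq_eq, dotProduct]
  exact Finset.sum_congr rfl fun i _ => by ring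

theorem norm_sq_le_quadForm_inv {A : Matrix (Fin d) (Fin d) ℝ} (hA : A.PosDef) {m : ℝ}
    (hm0 : 0 ≤ m) (hm : ∀ i j, |A i j| ≤ m) (w : Coord d) :
    ‖w‖ ^ 2 ≤ ((d : ℝ) ^ 2 * m + 1) * quadForm A⁻¹ w := by
  have h1 := dotProduct_sq_le hA w w
  rw [dotProduct_self_eq_norm_sq] at h1
  have h0 := quadForm_nonneg_of_posDef hA.inv w
  have h2 := h1.trans (mul_le_mul_of_nonneg_left (quadForm_le hm w) h0)
  have h3 : 0 ≤ (d : ℝ) ^ 2 * m := by positivity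
  rcases (norm_nonneg w).eq_or_lt with h | h
  · rw [← h]
    simp only [ne_eq, OfNat.ofNat_ne_zero, not_false_eq_true, zero_pow]
    positivity
  · have h4 : 0 < ‖w‖ ^ 2 := by positivity
    have : ‖w‖ ^ 2 ≤ quadForm A⁻¹ w * ((d : ℝ) ^ 2 * m) := by
      by_contra! hlt
      nlinarith
    linarith

section Basis

theorem clm_apply_eq_sum (l : Coord d →L[ℝ] ℝ) (z : Coord d) :
    l z = ∑ k, l (EuclideanSpace.single k 1) * z k := by
  have h : z = ∑ k, z k • EuclideanSpace.single k (1 : ℝ) := by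
    ext i
    simp [Pi.single_apply]
  conv_lhs => rw [h]
  rw [map_sum]
  exact Finset.sum_congr rfl fun k _ => by rw [map_smul, smul_eq_mul, mul_comm]

theorem evalAt_linPoly_pd (f : Coord d → ℝ) (z : Coord d) :
    evalAt z (linPoly fun k => pd k f 0) = fderiv ℝ f 0 z := by
  rw [evalAt_linPoly, clm_apply_eq_sum]
  rfl

theorem evalAt_quadPoly_pd {f : Coord d → ℝ} (hf : ContDiff ℝ 2 f) (z : Coord d) :
    evalAt z (quadPoly fun k l => pd k (pd l f) 0) = fderiv ℝ (fderiv ℝ f) 0 z z / 2 := by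
  rw [evalAt_quadPoly, clm_apply_eq_sum (fderiv ℝ (fderiv ℝ f) 0 z) z]
  have h : ∀ l, fderiv ℝ (fderiv ℝ f) 0 z (EuclideanSpace.single l 1) =
      ∑ k, pd k (pd l f) 0 * z k := by
    intro l
    rw [fderiv_fderiv_apply hf, clm_apply_eq_sum]
    rfl
  simp only [h]
  rw [Finset.sum_comm]
  congr 1
  refine Finset.sum_congr rfl fun l _ => ?_
  rw [Finset.sum_mul]
  exact Finset.sum_congr rfl fun k _ => by ring

end Basis

section Local

variable (M : Coord d → Matrix (Fin d) (Fin d) ℝ) (b : Fin d → Coord d → ℝ) (c : Coord d → ℝ)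

/-- The exponent of the time-slice kernel, in the displacement `h` from the base point and for
duration `t`, with diffusion matrix `M`, drift `b` and potential `c` as functions of `h`. -/
def kernelExponent (t : ℝ) (h : Coord d) : ℝ :=
  halfLogDet M h - quadForm (M h)⁻¹ (fun i => h i - t * b i h) / (4 * t) + t * c h

/-- Logarithm of the ratio of the rescaled kernel (`t = ε²`, `h = ε z`) to its Gaussian limit. -/
def rescaledExponent (ε : ℝ) (z : Coord d) : ℝ :=
  (halfLogDet M (ε • z) - halfLogDet M 0)
    - (1 / 4) * ((∑ i, ∑ j, (z i - ε * b i (ε • z)) * (M (ε • z))⁻¹ i j * (z j - ε * b j (ε • z)))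
      - quadForm (M 0)⁻¹ z) + ε ^ 2 * c (ε • z)

theorem kernelExponent_smul {ε : ℝ} (hε : ε ≠ 0) (z : Coord d) :
    kernelExponent M b c (ε ^ 2) (ε • z) =
      (halfLogDet M 0 - quadForm (M 0)⁻¹ z / 4) + rescaledExponent M b c ε z := by
  have h1 : quadForm (M (ε • z))⁻¹ (fun i => (ε • z) i - ε ^ 2 * b i (ε • z)) / (4 * ε ^ 2) =
      (1 / 4) * (∑ i, ∑ j, (z i - ε * b i (ε • z)) * (M (ε • z))⁻¹ i j *
        (z j - ε * b j (ε • z))) := by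
    rw [div_eq_iff (by positivity), quadForm, Finset.mul_sum, Finset.sum_mul]
    refine Finset.sum_congr rfl fun i _ => ?_
    rw [Finset.mul_sum, Finset.sum_mul]
    refine Finset.sum_congr rfl fun j _ => ?_
    simp only [PiLp.smul_apply, smul_eq_mul]
    ring
  rw [kernelExponent, h1, rescaledExponent]
  ring

/-- The polynomial `firstPoly` for the derivatives of `M` and `b` at the origin. -/
def localFirst : MvPolynomial (Fin d) ℝ :=
  firstPoly (M 0)⁻¹ (fun i j k => pd k (fun y => M y i j) 0) (fun i => b i 0)

/-- The polynomial `secondPoly` for the derivatives of `M`, `b` and `c` at the origin. -/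
def localSecond : MvPolynomial (Fin d) ℝ :=
  secondPoly (M 0)⁻¹ (fun i j k => pd k (fun y => M y i j) 0)
    (fun i j k l => pd k (pd l fun y => M y i j) 0) (fun i => b i 0) (fun i k => pd k (b i) 0) (c 0)

variable {M b c}

open Matrix in
/-- The exponent is `ε P₁ + ε² L₂ + o(ε²)` with `P₁ = localFirst` and `½ P₁² + L₂ = localSecond`. -/
theorem expands_rescaledExponent (hM : ∀ i j, ContDiff ℝ 2 fun y => M y i j)
    (hpos : ∀ y, (M y).PosDef) (hb : ∀ i, ContDiff ℝ 1 (b i)) (hc : Continuous c) :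
    ∃ L₂ : Coord d → ℝ, (∀ z, evalAt z (localFirst M b) ^ 2 / 2 + L₂ z =
        evalAt z (localSecond M b c)) ∧
      ∀ᶠ δ in 𝓝[>] (0 : ℝ), Expands δ (rescaledExponent M b c) (fun _ => 0)
        (fun z => evalAt z (localFirst M b)) L₂ := by
  have hdet : ∀ y, 0 < (M y).det := fun y => (hpos y).det_pos
  have hT := contDiff_inv_entry hM fun y => (hdet y).ne'
  have hS := contDiff_halfLogDet hM hdet
  have eS := expands_of_isLittleO_sq (isLittleO_taylor_two hS)
  have eT : ∀ᶠ δ in 𝓝[>] (0 : ℝ), ∀ i j, _ := eventually_all.2 fun i => eventually_all.2 fun j =>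
    expands_of_isLittleO_sq (isLittleO_taylor_two (hT i j))
  have eb : ∀ᶠ δ in 𝓝[>] (0 : ℝ), ∀ i, _ := eventually_all.2 fun i =>
    expands_of_isLittleO (isLittleO_taylor_one (hb i))
  have ec := expands_of_continuousAt hc.continuousAt
  set A := (M 0)⁻¹ with hA
  have hAs : A.IsSymm := isSymm_of_posDef (hpos 0).inv
  set p₁ := localFirst M b
  set p₂ := localSecond M b c
  refine ⟨fun z => evalAt z p₂ - evalAt z p₁ ^ 2 / 2, fun z => by ring, ?_⟩
  filter_upwards [eS, eT, eb, ec] with δ eS eT eb ec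
  have ew : ∀ i, Expands δ (fun ε z => z i - ε * b i (ε • z)) _ _ _ := fun i =>
    ((PolyBdd.coord i).expands δ).sub (eb i)
  have eq := Expands.sum Finset.univ fun i => Expands.sum Finset.univ fun j =>
    ((ew i).mul (eT i j)).mul (ew j)
  have eq0 : PolyBdd fun z : Coord d => quadForm A z := by
    have e : (fun z : Coord d => quadForm A z) =
        fun z => evalAt z (∑ i, ∑ j, MvPolynomial.X i * MvPolynomial.C (A i j) *
          MvPolynomial.X j) := by
      ext z; simp [evalAt, quadForm]
    rw [e]
    exact polyBdd_evalAt _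
  have h := ((eS.sub ((PolyBdd.const (halfLogDet M 0)).expands δ)).sub
    ((eq.sub (eq0.expands δ)).const_mul (1 / 4))).add ec
  have hconv : ∀ {φ : ℝ → Coord d → ℝ} {φ₀ φ₁ φ₂ ψ₀ ψ₁ ψ₂ : Coord d → ℝ}, Expands δ φ φ₀ φ₁ φ₂ →
      (∀ z, φ₀ z = ψ₀ z) → (∀ z, φ₁ z = ψ₁ z ∧ φ₂ z = ψ₂ z) → Expands δ φ ψ₀ ψ₁ ψ₂ := by
    intro φ φ₀ φ₁ φ₂ ψ₀ ψ₁ ψ₂ h e0 e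
    obtain rfl : φ₀ = ψ₀ := funext e0
    obtain rfl : φ₁ = ψ₁ := funext fun z => (e z).1
    obtain rfl : φ₂ = ψ₂ := funext fun z => (e z).2
    exact h
  refine hconv h (fun z => ?_) fun z => ?_
  · simp only [sub_self, sub_zero, quadForm, add_zero, zero_sub]
    ring
  -- the coefficients, for a fixed direction `z`
  set Q := dirDeriv M z 0 with hQ
  set R := (1 / 2 : ℝ) • dirDeriv (dirDeriv M z) z 0 with hR
  have hQs : Q.IsSymm := by
    ext i j
    have : (fun y => M y j i) = fun y => M y i j := by
      ext y; exact (isSymm_of_posDef (hpos y)).apply _ _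
    simp [hQ, dirDeriv, transpose_apply, this]
  set v : Fin d → ℝ := (1 / 2 : ℝ) • A *ᵥ z with hv
  set β : Fin d → ℝ := fun i => fderiv ℝ (b i) 0 z with hβ
  set b₀ : Fin d → ℝ := fun i => b i 0 with hb₀
  have v1 : ∀ i, evalAt z (score A i) = v i := by
    intro i; rw [evalAt_score, hv, Pi.smul_apply, smul_eq_mul]; ring
  have v2 : ∀ i j, evalAt z (linPoly fun k => pd k (fun y => M y i j) 0) = Q i j := fun i j =>
    evalAt_linPoly_pd _ z
  have v3 : ∀ i j, evalAt z (quadPoly fun k l => pd k (pd l fun y => M y i j) 0) = R i j := by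
    intro i j
    rw [evalAt_quadPoly_pd (hM i j), fderiv_fderiv_apply (hM i j), hR, Matrix.smul_apply,
      smul_eq_mul]
    simp only [dirDeriv, of_apply]
    ring
  have v4 : ∀ i, evalAt z (linPoly fun k => pd k (b i) 0) = β i := fun i => evalAt_linPoly_pd _ z
  have f1 := evalAt_firstPoly hAs b₀ z v v1 v2
  have f2 := evalAt_secondPoly hAs hQs b₀ (c 0) z v v1 v2 v3 v4
  have t1 : ∀ i j, fderiv ℝ (fun y => (M y)⁻¹ i j) 0 z = (-(A * Q * A)) i j := fun i j =>
    congrFun (congrFun (dirDeriv_inv hM hdet z 0) i) j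
  have t2 : ∀ i j, fderiv ℝ (fderiv ℝ fun y => (M y)⁻¹ i j) 0 z z / 2 =
      (A * Q * A * Q * A - A * R * A) i j := by
    intro i j
    have e1 := congrFun (congrFun (dirDeriv_dirDeriv_inv hM hdet z 0) i) j
    have e2 : dirDeriv (dirDeriv (fun y => (M y)⁻¹) z) z 0 i j =
        fderiv ℝ (fderiv ℝ fun y => (M y)⁻¹ i j) 0 z z := (fderiv_fderiv_apply (hT i j) 0 z z).symm
    rw [← e2, e1, hR, Matrix.mul_smul, Matrix.smul_mul, Matrix.sub_apply, Matrix.sub_apply,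
      Matrix.smul_apply, Matrix.smul_apply, smul_eq_mul, smul_eq_mul]
    ring
  have s1 : fderiv ℝ (halfLogDet M) 0 z = -(A * Q).trace / 2 := fderiv_halfLogDet hM hdet z 0
  have s2 : fderiv ℝ (fderiv ℝ (halfLogDet M)) 0 z z / 2 =
      (A * Q * A * Q).trace / 4 - (A * R).trace / 2 := by
    rw [fderiv_fderiv_halfLogDet hM hdet z 0, hR, Matrix.mul_smul, trace_smul, smul_eq_mul]
    ring
  have bil : ∀ (x y : Fin d → ℝ) (X : Matrix (Fin d) (Fin d) ℝ),
      ∑ i, ∑ j, x i * X i j * y j = x ⬝ᵥ X *ᵥ y := by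
    intro x y X
    rw [dotProduct_mulVec_eq_sum]
    exact Finset.sum_congr rfl fun i _ => Finset.sum_congr rfl fun j _ => by ring
  have hAz : A *ᵥ z = (2 : ℝ) • v := by rw [hv, smul_smul]; norm_num
  have left : ∀ (X : Matrix (Fin d) (Fin d) ℝ) (y : Fin d → ℝ),
      (z : Fin d → ℝ) ⬝ᵥ (A * X) *ᵥ y = 2 * (v ⬝ᵥ X *ᵥ y) := by
    intro X y
    rw [← mulVec_mulVec, dotProduct_mulVec, ← mulVec_transpose, hAs.eq, hAz, smul_dotProduct,
      smul_eq_mul]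
  have right : ∀ (X : Matrix (Fin d) (Fin d) ℝ) (y : Fin d → ℝ),
      y ⬝ᵥ (X * A) *ᵥ z = 2 * (y ⬝ᵥ X *ᵥ v) := by
    intro X y
    rw [← mulVec_mulVec, hAz, mulVec_smul, dotProduct_smul, smul_eq_mul]
  have q1 : ∀ y : Fin d → ℝ, (z : Fin d → ℝ) ⬝ᵥ A *ᵥ y = 2 * (y ⬝ᵥ v) := by
    intro y
    have := left 1 y
    rwa [Matrix.mul_one, one_mulVec, dotProduct_comm v] at this
  have q2 : ∀ y : Fin d → ℝ, y ⬝ᵥ A *ᵥ z = 2 * (y ⬝ᵥ v) := by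
    intro y
    have := right 1 y
    rwa [Matrix.one_mul, one_mulVec] at this
  have q3 : (z : Fin d → ℝ) ⬝ᵥ (A * Q * A) *ᵥ z = 4 * (v ⬝ᵥ Q *ᵥ v) := by
    rw [Matrix.mul_assoc, left, right]; ring
  have q4 : (z : Fin d → ℝ) ⬝ᵥ (A * R * A) *ᵥ z = 4 * (v ⬝ᵥ R *ᵥ v) := by
    rw [Matrix.mul_assoc, left, right]; ring
  have q5 : (z : Fin d → ℝ) ⬝ᵥ (A * Q * A * Q * A) *ᵥ z = 4 * (v ⬝ᵥ (Q * A * Q) *ᵥ v) := by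
    rw [right, Matrix.mul_assoc, Matrix.mul_assoc, left, ← Matrix.mul_assoc]; ring
  have q6 : (z : Fin d → ℝ) ⬝ᵥ (A * Q * A) *ᵥ b₀ = 2 * (v ⬝ᵥ (Q * A) *ᵥ b₀) := by
    rw [Matrix.mul_assoc, left]
  have q7 : b₀ ⬝ᵥ (A * Q * A) *ᵥ z = 2 * (v ⬝ᵥ (Q * A) *ᵥ b₀) := by
    rw [right, dotProduct_mulVec, ← mulVec_transpose, transpose_mul, hAs.eq, hQs.eq,
      dotProduct_comm]
  constructor
  · refine Eq.trans ?_ f1.symm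
    have e : ∑ i, ∑ j, (((z i - 0) * (M 0)⁻¹ i j) * (0 - b j 0) + ((z i - 0) *
        fderiv ℝ (fun y => (M y)⁻¹ i j) 0 z + (0 - b i 0) * (M 0)⁻¹ i j) * (z j - 0)) =
        -((z : Fin d → ℝ) ⬝ᵥ A *ᵥ b₀) + (z : Fin d → ℝ) ⬝ᵥ (-(A * Q * A)) *ᵥ z
          - b₀ ⬝ᵥ A *ᵥ z := by
      rw [← bil, ← bil, ← bil]
      simp only [← Finset.sum_neg_distrib, ← Finset.sum_sub_distrib, ← Finset.sum_add_distrib, t1]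
      exact Finset.sum_congr rfl fun i _ => Finset.sum_congr rfl fun j _ => by ring
    rw [e, s1, q1, q2, neg_mulVec, dotProduct_neg, q3]
    ring
  · rw [show evalAt z p₂ = _ from f2, show evalAt z p₁ = _ from f1]
    have e : ∑ i, ∑ j, ((z i - 0) * (M 0)⁻¹ i j * (0 - fderiv ℝ (b j) 0 z) +
          ((z i - 0) * fderiv ℝ (fun y => (M y)⁻¹ i j) 0 z + (0 - b i 0) * (M 0)⁻¹ i j) *
            (0 - b j 0) +
          ((z i - 0) * (fderiv ℝ (fderiv ℝ fun y => (M y)⁻¹ i j) 0 z z / 2) +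
            (0 - b i 0) * fderiv ℝ (fun y => (M y)⁻¹ i j) 0 z +
            (0 - fderiv ℝ (b i) 0 z) * (M 0)⁻¹ i j) * (z j - 0)) =
        -((z : Fin d → ℝ) ⬝ᵥ A *ᵥ β) - (z : Fin d → ℝ) ⬝ᵥ (-(A * Q * A)) *ᵥ b₀ + b₀ ⬝ᵥ A *ᵥ b₀
          + (z : Fin d → ℝ) ⬝ᵥ (A * Q * A * Q * A - A * R * A) *ᵥ z
          - b₀ ⬝ᵥ (-(A * Q * A)) *ᵥ z - β ⬝ᵥ A *ᵥ z := by
      rw [← bil, ← bil, ← bil, ← bil, ← bil, ← bil]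
      simp only [← Finset.sum_neg_distrib, ← Finset.sum_sub_distrib, ← Finset.sum_add_distrib,
        t1, t2]
      exact Finset.sum_congr rfl fun i _ => Finset.sum_congr rfl fun j _ => by ring
    rw [e, s2, q1, q2, neg_mulVec, neg_mulVec, dotProduct_neg, dotProduct_neg, sub_mulVec,
      dotProduct_sub, q4, q5, q6, q7]
    ring

end Local

/-! ### Small and large displacements -/

section Inner

variable {M : Coord d → Matrix (Fin d) (Fin d) ℝ} {b : Fin d → Coord d → ℝ} {c : Coord d → ℝ}

theorem exists_norm_sq_le_quadForm_inv {A : Matrix (Fin d) (Fin d) ℝ} (hA : A.PosDef) :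
    ∃ lam, 0 < lam ∧ ∀ z : Coord d, lam * ‖z‖ ^ 2 ≤ quadForm A⁻¹ z := by
  set m := ∑ i, ∑ j, |A i j| with hm
  have hm0 : 0 ≤ m := by positivity
  have hmA : ∀ i j, |A i j| ≤ m := fun i j =>
    (Finset.single_le_sum (f := fun j => |A i j|) (fun j _ => abs_nonneg _)
      (Finset.mem_univ j)).trans (Finset.single_le_sum (f := fun i => ∑ j, |A i j|)
        (fun i _ => by positivity) (Finset.mem_univ i))
  refine ⟨((d : ℝ) ^ 2 * m + 1)⁻¹, by positivity, fun z => ?_⟩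
  rw [inv_mul_le_iff₀ (by positivity)]
  exact norm_sq_le_quadForm_inv hA hm0 hmA z

/-- On the unit ball the rescaled kernel is dominated by a Gaussian, uniformly in `ε`. -/
theorem exists_kernelExponent_smul_le (hM : ∀ i j, ContDiff ℝ 2 fun y => M y i j)
    (hpos : ∀ y, (M y).PosDef) (hb : ∀ i, Continuous (b i)) (hc : Continuous c) :
    ∃ lam K, 0 < lam ∧ ∀ ε z, 0 < ε → ε ≤ 1 → ε * ‖z‖ ≤ 1 →
      kernelExponent M b c (ε ^ 2) (ε • z) ≤ K - lam * ‖z‖ ^ 2 := by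
  have hS := (contDiff_halfLogDet hM fun y => (hpos y).det_pos).continuous
  have hcomp : IsCompact (Metric.closedBall (0 : Coord d) 1) := isCompact_closedBall 0 1
  have hball : ∀ {f : Coord d → ℝ}, Continuous f →
      ∃ K, 0 ≤ K ∧ ∀ h : Coord d, ‖h‖ ≤ 1 → |f h| ≤ K := by
    intro f hf
    obtain ⟨K, hK⟩ := hcomp.exists_bound_of_continuousOn hf.continuousOn
    refine ⟨|K|, abs_nonneg _, fun h hh => (hK h ?_).trans (le_abs_self K)⟩
    rwa [mem_closedBall_zero_iff]
  obtain ⟨s, hs0, hs⟩ := hball hS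
  obtain ⟨m, hm0, hm⟩ := hball (f := fun h => ∑ i, ∑ j, |M h i j|)
    (continuous_finsetSum _ fun i _ => continuous_finsetSum _ fun j _ => (hM i j).continuous.abs)
  obtain ⟨k, hk0, hk⟩ := hball hc
  have hbv : Continuous fun h : Coord d => (WithLp.toLp 2 fun i => b i h : Coord d) :=
    (PiLp.continuous_toLp 2 _).comp (continuous_pi hb)
  obtain ⟨β, hβ0, hβ⟩ := hball hbv.norm
  set n := (d : ℝ) ^ 2 * m + 1 with hn
  have hn0 : 0 < n := by positivity
  refine ⟨1 / (8 * n), s + k + β ^ 2 / (4 * n), by positivity, fun ε z h1 h2 h3 => ?_⟩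
  have hz : ‖ε • z‖ ≤ 1 := by rwa [norm_smul, Real.norm_of_nonneg h1.le]
  set h := ε • z with hh
  set w : Coord d := z - ε • (WithLp.toLp 2 fun i => b i h : Coord d) with hw
  have e1 : quadForm (M h)⁻¹ (fun i => h i - ε ^ 2 * b i h) / (4 * ε ^ 2) =
      quadForm (M h)⁻¹ w / 4 := by
    rw [div_eq_div_iff (by positivity) (by positivity), quadForm, quadForm, Finset.sum_mul,
      Finset.sum_mul]
    refine Finset.sum_congr rfl fun i _ => ?_
    rw [Finset.sum_mul, Finset.sum_mul]
    refine Finset.sum_congr rfl fun j _ => ?_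
    simp only [hw, hh, PiLp.smul_apply, PiLp.sub_apply, smul_eq_mul]
    ring
  have hme : ∀ i j, |M h i j| ≤ m := fun i j =>
    ((Finset.single_le_sum (f := fun j => |M h i j|) (fun j _ => abs_nonneg _)
      (Finset.mem_univ j)).trans (Finset.single_le_sum (f := fun i => ∑ j, |M h i j|)
        (fun i _ => by positivity) (Finset.mem_univ i))).trans ((le_abs_self _).trans (hm h hz))
  have e2 : ‖w‖ ^ 2 ≤ n * quadForm (M h)⁻¹ w := norm_sq_le_quadForm_inv (hpos h) hm0 hme w
  have e3 : ‖z‖ ≤ ‖w‖ + β := by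
    have : z = w + ε • (WithLp.toLp 2 fun i => b i h : Coord d) := by rw [hw]; abel
    calc ‖z‖ = ‖w + ε • (WithLp.toLp 2 fun i => b i h : Coord d)‖ := by rw [← this]
      _ ≤ ‖w‖ + ‖ε • (WithLp.toLp 2 fun i => b i h : Coord d)‖ := norm_add_le _ _
      _ ≤ ‖w‖ + β := by
        gcongr
        rw [norm_smul, Real.norm_of_nonneg h1.le]
        have := (le_abs_self _).trans (hβ h hz)
        exact (mul_le_of_le_one_left (norm_nonneg _) h2).trans this
  have e4 : ‖z‖ ^ 2 / 2 - β ^ 2 ≤ ‖w‖ ^ 2 := by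
    have : ‖z‖ ^ 2 ≤ (‖w‖ + β) ^ 2 := by gcongr
    nlinarith [sq_nonneg (‖w‖ - β)]
  have e5 : (‖z‖ ^ 2 / 2 - β ^ 2) / n ≤ quadForm (M h)⁻¹ w := by
    rw [div_le_iff₀' hn0]; linarith
  have e6 : ε ^ 2 * c h ≤ k := by
    have h6 := hk h hz
    have h7 : ε ^ 2 ≤ 1 := pow_le_one₀ h1.le h2
    calc ε ^ 2 * c h ≤ ε ^ 2 * |c h| := by gcongr; exact le_abs_self _
      _ ≤ |c h| := mul_le_of_le_one_left (abs_nonneg _) h7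
      _ ≤ k := h6
  have e7 : 1 / (8 * n) * ‖z‖ ^ 2 - β ^ 2 / (4 * n) = (‖z‖ ^ 2 / 2 - β ^ 2) / n / 4 := by
    field_simp
    ring
  rw [kernelExponent, e1]
  linarith [(le_abs_self _).trans (hs h hz)]

theorem continuous_kernelExponent (hM : ∀ i j, ContDiff ℝ 2 fun y => M y i j)
    (hpos : ∀ y, (M y).PosDef) (hb : ∀ i, Continuous (b i)) (hc : Continuous c) (t : ℝ) :
    Continuous (kernelExponent M b c t) := by
  have hS := (contDiff_halfLogDet hM fun y => (hpos y).det_pos).continuous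
  have hT := fun i j => (contDiff_inv_entry hM (fun y => (hpos y).det_pos.ne') i j).continuous
  have hu : ∀ i, Continuous fun h : Coord d => h i - t * b i h := fun i =>
    (by fun_prop : Continuous fun h : Coord d => h i).sub ((hb i).const_mul t)
  exact (hS.sub ((continuous_finsetSum _ fun i _ => continuous_finsetSum _ fun j _ =>
    ((hu i).mul (hT i j)).mul (hu j)).div_const _)).add (hc.const_mul t)

/-- Expansion of the contribution of displacements of length at most `δ` to the rescaled
moments. -/
theorem eventually_isLittleO_inner (hM : ∀ i j, ContDiff ℝ 2 fun y => M y i j)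
    (hpos : ∀ y, (M y).PosDef) (hb : ∀ i, ContDiff ℝ 1 (b i)) (hc : Continuous c)
    {s lam : ℝ} {A : Matrix (Fin d) (Fin d) ℝ} (hs : halfLogDet M 0 = s) (hAM : (M 0)⁻¹ = A)
    (hlam : 0 < lam) (hA : ∀ z : Coord d, lam * ‖z‖ ^ 2 ≤ quadForm A z) :
    ∀ᶠ δ in 𝓝[>] (0 : ℝ), ∀ p : MvPolynomial (Fin d) ℝ,
      (fun ε => (∫ z in {z | ε * ‖z‖ ≤ δ},
          evalAt z p * Real.exp (kernelExponent M b c (ε ^ 2) (ε • z)))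
        - (gaussFunctional s A hlam hA p + ε * gaussFunctional s A hlam hA (p * localFirst M b)
          + ε ^ 2 * gaussFunctional s A hlam hA (p * localSecond M b c)))
        =o[𝓝[>] 0] fun ε => ε ^ 2 := by
  obtain ⟨L₂, hL, hexp⟩ := expands_rescaledExponent hM hpos hb hc
  obtain ⟨lam', K, hlam', hK⟩ :=
    exists_kernelExponent_smul_le hM hpos (fun i => (hb i).continuous) hc
  have he : ∀ ε z, 0 < ε → gaussWeight s A z * Real.exp (rescaledExponent M b c ε z) =
      Real.exp (kernelExponent M b c (ε ^ 2) (ε • z)) := by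
    intro ε z hε
    rw [kernelExponent_smul M b c hε.ne', gaussWeight, ← Real.exp_add, hs, hAM]
  have hm : ∀ ε, 0 < ε → Measurable (rescaledExponent M b c ε) := by
    intro ε hε
    have : rescaledExponent M b c ε = fun z => kernelExponent M b c (ε ^ 2) (ε • z) -
        (s - quadForm A z / 4) := by
      ext z
      rw [kernelExponent_smul M b c hε.ne', hs, hAM]
      ring
    rw [this]
    refine Continuous.measurable ?_
    have h1 := continuous_kernelExponent hM hpos (fun i => (hb i).continuous) hc (ε ^ 2)
    have h2 := continuous_quadForm A
    fun_prop
  filter_upwards [hexp, Ioc_mem_nhdsGT one_pos] with δ hδ hδ1 p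
  have key := isLittleO_setIntegral_expansion (s := s) (K := Real.exp K) hlam hA hδ1.1 hlam' hδ hL
    hm (fun ε z h1 h2 h3 => by
      rw [he ε z h1, ← Real.exp_add, Real.exp_le_exp]
      linarith [hK ε z h1 h2 (h3.trans hδ1.2)]) p
  refine key.congr' ?_ EventuallyEq.rfl
  filter_upwards [self_mem_nhdsWithin] with ε hε
  simp only [he ε _ hε]

end Inner

section Outer

variable {M : Coord d → Matrix (Fin d) (Fin d) ℝ} {b : Fin d → Coord d → ℝ} {c : Coord d → ℝ}

/-- Away from the base point the kernel is exponentially small in `1 / t`, with stretched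
exponential decay at infinity. -/
def HasTailBound (M : Coord d → Matrix (Fin d) (Fin d) ℝ) (b : Fin d → Coord d → ℝ)
    (c : Coord d → ℝ) : Prop :=
  ∃ s : ℝ, 0 < s ∧ ∀ δ : ℝ, 0 < δ → ∃ a : ℝ, 0 < a ∧ ∀ᶠ t in 𝓝[>] (0 : ℝ), ∀ h : Coord d, δ ≤ ‖h‖ →
    kernelExponent M b c t h ≤ -(a / t) * (1 + ‖h‖) ^ s

theorem HasTailBound.exists_bound (ht : HasTailBound M b c) {δ : ℝ} (hδ : 0 < δ) :
    ∃ s a : ℝ, 0 < s ∧ 0 < a ∧ ∀ᶠ t in 𝓝[>] (0 : ℝ), ∀ h : Coord d, δ ≤ ‖h‖ →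
      Real.exp (kernelExponent M b c t h) ≤
        Real.exp (-(a / t)) * Real.exp (-a * (1 + ‖h‖) ^ s) := by
  obtain ⟨s, hs, h⟩ := ht
  obtain ⟨a, ha, h⟩ := h δ hδ
  refine ⟨s, a / 2, hs, by positivity, ?_⟩
  filter_upwards [h, Ioc_mem_nhdsGT one_pos] with t h1 ht h hh
  rw [← Real.exp_add, Real.exp_le_exp]
  refine (h1 h hh).trans ?_
  have h2 : 1 ≤ (1 + ‖h‖) ^ s := Real.one_le_rpow (one_le_one_add_norm h) hs.le
  have h3 : a ≤ a / t := by
    rw [le_div_iff₀ ht.1]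
    nlinarith [ht.2]
  have h4 : a / 2 / t = a / t / 2 := by ring
  rw [h4]
  nlinarith

theorem eventually_integrable (hM : ∀ i j, ContDiff ℝ 2 fun y => M y i j)
    (hpos : ∀ y, (M y).PosDef) (hb : ∀ i, Continuous (b i)) (hc : Continuous c)
    (ht : HasTailBound M b c) :
    ∀ᶠ t in 𝓝[>] (0 : ℝ), ∀ p : MvPolynomial (Fin d) ℝ,
      Integrable fun h : Coord d => evalAt h p * Real.exp (kernelExponent M b c t h) := by
  obtain ⟨s, a, hs, ha, h⟩ := ht.exists_bound one_pos
  filter_upwards [h, self_mem_nhdsWithin] with t h (ht0 : 0 < t) p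
  have hcont : Continuous fun h : Coord d => evalAt h p * Real.exp (kernelExponent M b c t h) :=
    (continuous_evalAt p).mul (Real.continuous_exp.comp (continuous_kernelExponent hM hpos hb hc t))
  rw [← integrableOn_univ, ← Set.union_compl_self (Metric.closedBall (0 : Coord d) 1)]
  refine IntegrableOn.union (hcont.continuousOn.integrableOn_compact (isCompact_closedBall 0 1)) ?_
  obtain ⟨K, N, hK, hp⟩ := polyBdd_evalAt p
  have hi := (integrable_pow_mul_exp_neg_rpow (d := d) hs ha N).const_mul
    (K * Real.exp (-(a / t)))
  refine Integrable.mono' hi.integrableOn hcont.aestronglyMeasurable ?_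
  refine (ae_restrict_iff' measurableSet_closedBall.compl).2 (ae_of_all _ fun x hx => ?_)
  have hx' : 1 ≤ ‖x‖ := by
    rw [Set.mem_compl_iff, mem_closedBall_zero_iff, not_le] at hx
    exact hx.le
  rw [Real.norm_eq_abs, abs_mul, Real.abs_exp, mul_mul_mul_comm]
  exact mul_le_mul (hp x) (h x hx') (Real.exp_pos _).le (by positivity)

theorem isLittleO_exp_neg_div {a : ℝ} (ha : 0 < a) (n : ℕ) :
    (fun t : ℝ => Real.exp (-(a / t))) =o[𝓝[>] 0] fun t => t ^ n := by
  have h1 : (fun t : ℝ => Real.exp (-(a / t))) =O[𝓝[>] 0] fun t => t ^ (n + 1) := by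
    refine IsBigO.of_bound ((n + 1).factorial / a ^ (n + 1)) ?_
    filter_upwards [self_mem_nhdsWithin] with t (ht : 0 < t)
    have h2 := Real.pow_div_factorial_le_exp (a / t) (by positivity) (n + 1)
    rw [Real.norm_of_nonneg (Real.exp_pos _).le, Real.norm_of_nonneg (by positivity),
      Real.exp_neg, inv_le_comm₀ (Real.exp_pos _) (by positivity)]
    refine le_trans (le_of_eq ?_) h2
    rw [div_pow]
    field_simp
  exact h1.trans_isLittleO ((isLittleO_pow_pow (Nat.lt_succ_self n)).mono nhdsWithin_le_nhds)

theorem isLittleO_outer (ht : HasTailBound M b c) {δ : ℝ} (hδ : 0 < δ)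
    (p : MvPolynomial (Fin d) ℝ) (n : ℕ) :
    (fun t => ∫ h in {h : Coord d | ‖h‖ ≤ δ}ᶜ, evalAt h p * Real.exp (kernelExponent M b c t h))
      =o[𝓝[>] 0] fun t => t ^ n := by
  obtain ⟨s, a, hs, ha, h⟩ := ht.exists_bound hδ
  obtain ⟨K, N, hK, hp⟩ := polyBdd_evalAt p
  have hi := (integrable_pow_mul_exp_neg_rpow (d := d) hs ha N)
  refine IsBigO.trans_isLittleO (IsBigO.of_bound
    (K * ∫ z : Coord d, (1 + ‖z‖) ^ N * Real.exp (-a * (1 + ‖z‖) ^ s)) ?_)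
    (isLittleO_exp_neg_div ha n)
  filter_upwards [h] with t h
  have hms : MeasurableSet {h : Coord d | ‖h‖ ≤ δ}ᶜ :=
    (measurableSet_le (by fun_prop) (by fun_prop)).compl
  rw [Real.norm_of_nonneg (Real.exp_pos (-(a / t))).le]
  calc _ ≤ ∫ z in {h : Coord d | ‖h‖ ≤ δ}ᶜ, K * Real.exp (-(a / t)) *
        ((1 + ‖z‖) ^ N * Real.exp (-a * (1 + ‖z‖) ^ s)) := by
        refine norm_integral_le_of_norm_le (hi.const_mul _).integrableOn ?_
        refine (ae_restrict_iff' hms).2 (ae_of_all _ fun x hx => ?_)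
        have hx' : δ ≤ ‖x‖ := (not_le.1 (show ¬‖x‖ ≤ δ from hx)).le
        rw [Real.norm_eq_abs, abs_mul, Real.abs_exp, mul_mul_mul_comm]
        exact mul_le_mul (hp x) (h x hx') (Real.exp_pos _).le (by positivity)
    _ ≤ ∫ z : Coord d, K * Real.exp (-(a / t)) *
        ((1 + ‖z‖) ^ N * Real.exp (-a * (1 + ‖z‖) ^ s)) :=
        setIntegral_le_integral (hi.const_mul _) (ae_of_all _ fun z => by
          simp only [Pi.zero_apply]
          positivity)
    _ = _ := by rw [integral_const_mul]; ring

end Outer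

/-! ### Comparison of moments -/

section Moments

variable {M : Coord d → Matrix (Fin d) (Fin d) ℝ} {b : Fin d → Coord d → ℝ} {c : Coord d → ℝ}

/-- The monomial `z^{i₁} ⋯ z^{i_m}`. -/
def monom {m : ℕ} (i : Fin m → Fin d) : MvPolynomial (Fin d) ℝ := ∏ k, MvPolynomial.X (i k)

theorem evalAt_monom {m : ℕ} (i : Fin m → Fin d) (z : Coord d) :
    evalAt z (monom i) = ∏ k, z (i k) := by
  simp [evalAt, monom]

theorem evalAt_smul_monom {m : ℕ} (i : Fin m → Fin d) (ε : ℝ) (z : Coord d) :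
    evalAt (ε • z) (monom i) = ε ^ m * evalAt z (monom i) := by
  simp [evalAt_monom, Finset.prod_mul_distrib]

theorem setIntegral_rescale {δ ε : ℝ} (hε : 0 < ε) (f : Coord d → ℝ) :
    ∫ h in {h : Coord d | ‖h‖ ≤ δ}, f h =
      ε ^ d * ∫ z in {z : Coord d | ε * ‖z‖ ≤ δ}, f (ε • z) := by
  have h1 : MeasurableSet {h : Coord d | ‖h‖ ≤ δ} := measurableSet_le (by fun_prop) (by fun_prop)
  have h2 : MeasurableSet {z : Coord d | ε * ‖z‖ ≤ δ} :=
    measurableSet_le (by fun_prop) (by fun_prop)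
  rw [← integral_indicator h1, ← integral_indicator h2]
  have h3 : ∀ z, {z : Coord d | ε * ‖z‖ ≤ δ}.indicator (fun z => f (ε • z)) z =
      {h : Coord d | ‖h‖ ≤ δ}.indicator f (ε • z) := by
    intro z
    simp only [Set.indicator_apply, Set.mem_ofPred_eq, norm_smul, Real.norm_of_nonneg hε.le]
  simp only [h3]
  rw [Measure.integral_comp_smul, finrank_euclideanSpace_fin, abs_of_pos (by positivity),
    smul_eq_mul, mul_inv_cancel_left₀ (by positivity)]

/-- Expansion of the unnormalized moments; the Jacobian and the homogeneity of the monomial give the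
factor `ε ^ (d + m)`. -/
theorem isLittleO_integral_monom (hM : ∀ i j, ContDiff ℝ 2 fun y => M y i j)
    (hpos : ∀ y, (M y).PosDef) (hb : ∀ i, ContDiff ℝ 1 (b i)) (hc : Continuous c)
    (ht : HasTailBound M b c)
    {s lam : ℝ} {A : Matrix (Fin d) (Fin d) ℝ} (hs : halfLogDet M 0 = s) (hAM : (M 0)⁻¹ = A)
    (hlam : 0 < lam) (hA : ∀ z : Coord d, lam * ‖z‖ ^ 2 ≤ quadForm A z) {m : ℕ}
    (i : Fin m → Fin d) :
    (fun ε => (∫ h : Coord d, evalAt h (monom i) * Real.exp (kernelExponent M b c (ε ^ 2) h))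
      - ε ^ (d + m) * (gaussFunctional s A hlam hA (monom i)
        + ε * gaussFunctional s A hlam hA (monom i * localFirst M b)
        + ε ^ 2 * gaussFunctional s A hlam hA (monom i * localSecond M b c)))
      =o[𝓝[>] 0] fun ε => ε ^ (d + m + 2) := by
  have hsq : Tendsto (fun ε : ℝ => ε ^ 2) (𝓝[>] 0) (𝓝[>] 0) := by
    refine tendsto_nhdsWithin_iff.2 ⟨?_, ?_⟩
    · have : Tendsto (fun ε : ℝ => ε ^ 2) (𝓝 0) (𝓝 (0 ^ 2)) := (continuous_pow 2).tendsto 0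
      rw [zero_pow two_ne_zero] at this
      exact this.mono_left nhdsWithin_le_nhds
    · filter_upwards [self_mem_nhdsWithin] with ε (hε : 0 < ε)
      exact pow_pos hε 2
  obtain ⟨δ, hin, hδ⟩ :=
    ((eventually_isLittleO_inner hM hpos hb hc hs hAM hlam hA).and self_mem_nhdsWithin).exists
  have h1 := (isBigO_refl (fun ε : ℝ => ε ^ (d + m)) (𝓝[>] 0)).mul_isLittleO (hin (monom i))
  have h2 := (isLittleO_outer ht hδ (monom i) (d + m + 2)).comp_tendsto hsq
  have h3 : (fun ε : ℝ => (ε ^ 2) ^ (d + m + 2)) =O[𝓝[>] 0] fun ε => ε ^ (d + m + 2) := by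
    refine IsBigO.of_bound 1 ?_
    filter_upwards [Ioc_mem_nhdsGT one_pos] with ε hε
    have := hε.1
    rw [Real.norm_of_nonneg (by positivity), Real.norm_of_nonneg (by positivity), one_mul]
    exact pow_le_pow_left₀ (by positivity) (pow_le_of_le_one hε.1.le hε.2 two_ne_zero) _
  have h4 := (h1.congr_right fun ε => (pow_add ε (d + m) 2).symm).add (h2.trans_isBigO h3)
  refine h4.congr' ?_ EventuallyEq.rfl
  filter_upwards [self_mem_nhdsWithin, hsq.eventually (eventually_integrable hM hpos
    (fun i => (hb i).continuous) hc ht)] with ε (hε : 0 < ε) hint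
  have hms : MeasurableSet {h : Coord d | ‖h‖ ≤ δ} := measurableSet_le (by fun_prop) (by fun_prop)
  rw [← integral_add_compl hms (hint (monom i)), setIntegral_rescale hε]
  simp only [evalAt_smul_monom, mul_assoc, integral_const_mul, Function.comp_apply]
  ring

/-- The moments of the kernel with exponent `kernelExponent M b c`. -/
def localMoment (M : Coord d → Matrix (Fin d) (Fin d) ℝ) (b : Fin d → Coord d → ℝ)
    (c : Coord d → ℝ) {m : ℕ} (i : Fin m → Fin d) (t : ℝ) : ℝ :=
  1 / Real.sqrt ((4 * Real.pi * t) ^ d) *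
    ∫ h : Coord d, (∏ k, h (i k)) * Real.exp (kernelExponent M b c t h)

/-- Two kernels have the same moments up to order `t` if they have the same diffusion matrix at
the base point, the same effective drift and the same effective potential. -/
theorem isLittleO_localMoment_sub {M' : Coord d → Matrix (Fin d) (Fin d) ℝ}
    {b' : Fin d → Coord d → ℝ} {c' : Coord d → ℝ}
    (hM : ∀ i j, ContDiff ℝ 2 fun y => M y i j)
    (hpos : ∀ y, (M y).PosDef) (hb : ∀ i, ContDiff ℝ 1 (b i)) (hc : Continuous c)
    (ht : HasTailBound M b c)
    (hM' : ∀ i j, ContDiff ℝ 2 fun y => M' y i j)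
    (hpos' : ∀ y, (M' y).PosDef) (hb' : ∀ i, ContDiff ℝ 1 (b' i)) (hc' : Continuous c')
    (ht' : HasTailBound M' b' c') (h0 : M 0 = M' 0)
    (h1 : ∀ i, 2 * divD M 0 i + b i 0 = 2 * divD M' 0 i + b' i 0)
    (h2 : ddivD M 0 + ∑ i, pd i (b i) 0 + c 0 = ddivD M' 0 + ∑ i, pd i (b' i) 0 + c' 0)
    {m : ℕ} (i : Fin m → Fin d) :
    (fun t => localMoment M b c i t - localMoment M' b' c' i t) =o[𝓝[>] 0] fun t => t := by
  obtain ⟨lam, hlam, hA⟩ := exists_norm_sq_le_quadForm_inv (hpos 0)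
  set s := halfLogDet M 0 with hs
  set A := (M 0)⁻¹ with hAM
  set L := gaussFunctional s A hlam hA with hL
  have hSt : IsStein A L := isStein_gaussFunctional s (isSymm_of_posDef (hpos 0).inv) hlam hA
  have hA' : (M' 0)⁻¹ = A := by rw [hAM, h0]
  have hs' : halfLogDet M' 0 = s := by rw [hs, halfLogDet, halfLogDet, h0]
  have symm : ∀ {N : Coord d → Matrix (Fin d) (Fin d) ℝ}, (∀ y, (N y).PosDef) → ∀ i j,
      (fun y => N y i j) = fun y => N y j i := fun hN i j =>
    funext fun y => ((isSymm_of_posDef (hN y)).apply i j).symm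
  -- the effective drift and the effective potential in terms of the Gaussian functional
  have drift : ∀ {N : Coord d → Matrix (Fin d) (Fin d) ℝ} (a : Fin d → Coord d → ℝ),
      (∀ y, (N y).PosDef) → (N 0)⁻¹ = A → ∀ k, L (MvPolynomial.X k * localFirst N a) =
        (2 * divD N 0 k + a k 0) * L 1 := by
    intro N a hN hNA k
    rw [localFirst, hNA, hSt.apply_X_mul_firstPoly]
    simp only [symm hN _ k, divD, two_mul, Finset.sum_add_distrib]
  have pot : ∀ {N : Coord d → Matrix (Fin d) (Fin d) ℝ} (a : Fin d → Coord d → ℝ)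
      (e : Coord d → ℝ), (∀ y, (N y).PosDef) → (N 0)⁻¹ = A → L (localSecond N a e) =
        (ddivD N 0 + ∑ i, pd i (a i) 0 + e 0) * L 1 := by
    intro N a e hN hNA
    rw [localSecond, hNA, hSt.apply_secondPoly, ddivD]
    congr 3
    simp only [add_div, Finset.sum_add_distrib]
    have : ∑ i, ∑ j, pd j (pd i fun y => N y i j) 0 / 2 =
        ∑ i, ∑ j, pd i (pd j fun y => N y i j) 0 / 2 := by
      rw [Finset.sum_comm]
      exact Finset.sum_congr rfl fun i _ => Finset.sum_congr rfl fun j _ => by rw [symm hN]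
    rw [this]
    simp only [← Finset.sum_add_distrib, add_halves]
  have e1 := isLittleO_integral_monom hM hpos hb hc ht hs.symm hAM.symm hlam hA i
  have e2 := isLittleO_integral_monom hM' hpos' hb' hc' ht' hs' hA' hlam hA i
  have e3 := e1.sub e2
  rw [← hL] at e3
  set I : ℝ → ℝ := fun t =>
    ∫ h : Coord d, (∏ k, h (i k)) * Real.exp (kernelExponent M b c t h) with hI
  set I' : ℝ → ℝ := fun t =>
    ∫ h : Coord d, (∏ k, h (i k)) * Real.exp (kernelExponent M' b' c' t h) with hI'
  simp only [evalAt_monom] at e3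
  -- the difference of the integrals, up to the factor `ε ^ d` of the normalization
  have key : (fun ε : ℝ => I (ε ^ 2) - I' (ε ^ 2)) =o[𝓝[>] 0] fun ε => ε ^ (d + 2) := by
    have hle : (fun ε : ℝ => ε ^ (d + m + 2)) =O[𝓝[>] 0] fun ε => ε ^ (d + 2) :=
      IsBigO.of_bound 1 (by
        filter_upwards [Ioc_mem_nhdsGT one_pos] with ε hε
        have := hε.1
        rw [Real.norm_of_nonneg (by positivity), Real.norm_of_nonneg (by positivity), one_mul]
        exact pow_le_pow_of_le_one hε.1.le hε.2 (by omega))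
    have e4 := e3.trans_isBigO hle
    suffices h : (fun ε : ℝ => ε ^ (d + m) *
        (ε * (L (monom i * localFirst M b) - L (monom i * localFirst M' b')) +
          ε ^ 2 * (L (monom i * localSecond M b c) - L (monom i * localSecond M' b' c'))))
        =o[𝓝[>] 0] fun ε => ε ^ (d + 2) by
      refine (e4.add h).congr_left fun ε => ?_
      simp only [hI, hI']
      ring
    have hpow : ∀ (n : ℕ) (a : ℝ), d + 2 < n →
        (fun ε : ℝ => ε ^ n * a) =o[𝓝[>] 0] fun ε => ε ^ (d + 2) := by
      intro n a hn
      have := ((isLittleO_pow_pow hn).mono nhdsWithin_le_nhds (l := 𝓝[>] (0 : ℝ))).const_mul_left a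
      simpa only [mul_comm a] using this
    -- for `m ≤ 1` all terms up to the order `ε ^ (d + 2)` cancel, for `m ≥ 2` there are none
    rcases m with _ | _ | m
    · have hm : monom i = 1 := by simp [monom]
      have f1 : L (localFirst M b) = 0 := hSt.apply_firstPoly _ _
      have f2 : L (localFirst M' b') = 0 := by
        rw [localFirst, hA']; exact hSt.apply_firstPoly _ _
      simp only [hm, one_mul, f1, f2, pot b c hpos rfl, pot b' c' hpos' hA', h2, sub_self, mul_zero,
        add_zero]
      exact isLittleO_zero _ _
    · have hm : monom i = MvPolynomial.X (i 0) := by simp [monom]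
      have f1 := drift b hpos rfl (i 0)
      have f2 := drift b' hpos' hA' (i 0)
      rw [hm, f1, f2, h1, sub_self]
      refine (hpow (d + 3) (L (MvPolynomial.X (i 0) * localSecond M b c) -
        L (MvPolynomial.X (i 0) * localSecond M' b' c')) (by omega)).congr_left fun ε => ?_
      ring
    · refine ((hpow (d + (m + 2) + 1) (L (monom i * localFirst M b) -
        L (monom i * localFirst M' b')) (by omega)).add (hpow (d + (m + 2) + 2)
        (L (monom i * localSecond M b c) - L (monom i * localSecond M' b' c'))
          (by omega))).congr_left fun ε => ?_
      ring
  -- return to `t = ε ^ 2`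
  have hsqrt : Tendsto Real.sqrt (𝓝[>] 0) (𝓝[>] 0) := by
    refine tendsto_nhdsWithin_iff.2 ⟨?_, ?_⟩
    · have : Tendsto Real.sqrt (𝓝 0) (𝓝 (Real.sqrt 0)) := Real.continuous_sqrt.tendsto 0
      rw [Real.sqrt_zero] at this
      exact this.mono_left nhdsWithin_le_nhds
    · filter_upwards [self_mem_nhdsWithin] with t ht
      exact Real.sqrt_pos.2 ht
  have key2 := key.comp_tendsto hsqrt
  have key3 := (isBigO_refl (fun t : ℝ => 1 / Real.sqrt ((4 * Real.pi * t) ^ d)) (𝓝[>]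
    0)).mul_isLittleO key2
  have hR : (fun t : ℝ => 1 / Real.sqrt ((4 * Real.pi * t) ^ d) *
      ((fun ε : ℝ => ε ^ (d + 2)) ∘ Real.sqrt) t) =ᶠ[𝓝[>] 0]
      fun t => 1 / Real.sqrt ((4 * Real.pi) ^ d) * t := by
    filter_upwards [self_mem_nhdsWithin] with t (ht : 0 < t)
    have g1 : Real.sqrt ((4 * Real.pi * t) ^ d) =
        Real.sqrt ((4 * Real.pi) ^ d) * Real.sqrt t ^ d := by
      rw [mul_pow, Real.sqrt_mul (by positivity)]
      congr 1
      rw [Real.sqrt_eq_iff_mul_self_eq (by positivity) (by positivity), ← mul_pow,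
        Real.mul_self_sqrt ht.le]
    have g2 : 0 < Real.sqrt t := Real.sqrt_pos.2 ht
    have g3 : 0 < Real.sqrt ((4 * Real.pi) ^ d) := Real.sqrt_pos.2 (by positivity)
    simp only [Function.comp_apply]
    rw [g1, pow_add, Real.sq_sqrt ht.le]
    field_simp
  have key4 := key3.trans_eventuallyEq hR
  refine (key4.trans_isBigO (isBigO_const_mul_self _ _ _)).congr' ?_ EventuallyEq.rfl
  filter_upwards [self_mem_nhdsWithin] with t (ht : 0 < t)
  simp only [Function.comp_apply, Real.sq_sqrt ht.le, localMoment, hI, hI']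
  ring

end Moments

/-! ### The time-slice kernels -/

theorem eventually_mul_le (a : ℝ) {e : ℝ} (he : 0 < e) : ∀ᶠ t in 𝓝[>] (0 : ℝ), t * a ≤ e := by
  have : Tendsto (fun t : ℝ => t * a) (𝓝 0) (𝓝 (0 * a)) :=
    (continuous_id.mul continuous_const).tendsto 0
  rw [zero_mul] at this
  exact (this.mono_left nhdsWithin_le_nhds).eventually (ge_mem_nhds he)

open Matrix in
/-- The Cauchy-Schwarz inequality for the diffusion matrix bounds the quadratic form in the exponent
from below by `‖h‖² / ‖M h‖`, as the drift cannot compensate the displacement for small `t`. This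
dominates the growth of the normalization and of the potential. -/
theorem hasTailBound_of_growth {M : Coord d → Matrix (Fin d) (Fin d) ℝ} {b : Fin d → Coord d → ℝ}
    {c : Coord d → ℝ} (hpos : ∀ y, (M y).PosDef) {κ C₁ C₂ B : ℝ} (hκ₂ : κ < 2) (hC₁ : 0 ≤ C₁)
    (hC₂ : 0 ≤ C₂) (h1 : ∀ h i j, |M h i j| ≤ C₁ * (1 + ‖h‖) ^ κ)
    (h2 : ∀ h, halfLogDet M h ≤ C₂ * (1 + ‖h‖) ^ (2 - κ))
    (h3 : ∀ h, c h ≤ C₂ * (1 + ‖h‖) ^ (2 - κ))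
    (h4 : ∀ h, ∑ i, h i * b i h ≤ B * (1 + ‖h‖) ^ 2) : HasTailBound M b c := by
  refine ⟨2 - κ, by linarith, fun δ hδ => ?_⟩
  set n := (d : ℝ) ^ 2 * C₁ + 1 with hn
  have hn0 : 0 < n := by positivity
  set θ := δ / (1 + δ) with hθ
  have hθ0 : 0 < θ := by positivity
  refine ⟨θ ^ 2 / (32 * n), by positivity, ?_⟩
  filter_upwards [Ioc_mem_nhdsGT one_pos, eventually_mul_le B (e := θ ^ 2 / 2) (by positivity),
    eventually_mul_le (2 * C₂) (e := θ ^ 2 / (32 * n)) (by positivity)] with t ht ht1 ht2 h hh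
  have ht0 := ht.1
  set r := ‖h‖ with hr
  have hr0 : 0 < r := hδ.trans_le hh
  set u := 1 + r with hu
  have hu0 : 0 < u := by positivity
  have hru : θ * u ≤ r := by
    rw [hθ, div_mul_eq_mul_div, div_le_iff₀ (by positivity)]
    nlinarith
  set w : Fin d → ℝ := fun i => h i - t * b i h with hw
  set q := quadForm (M h)⁻¹ w with hq
  have hq0 : 0 ≤ q := quadForm_nonneg_of_posDef (hpos h).inv w
  have e1 : r ^ 2 / 2 ≤ w ⬝ᵥ h := by
    have e2 : w ⬝ᵥ h = r ^ 2 - t * ∑ i, h i * b i h := by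
      rw [hr, ← dotProduct_self_eq_norm_sq, dotProduct, dotProduct, Finset.mul_sum,
        ← Finset.sum_sub_distrib]
      exact Finset.sum_congr rfl fun i _ => by simp only [hw]; ring
    have e3 : t * ∑ i, h i * b i h ≤ t * (B * u ^ 2) := by gcongr; exact h4 h
    have e4 : t * B * u ^ 2 ≤ θ ^ 2 / 2 * u ^ 2 := by gcongr
    have e5 : (θ * u) ^ 2 ≤ r ^ 2 := by gcongr
    rw [e2]
    nlinarith
  have e2 : r ^ 2 ≤ 4 * n * u ^ κ * q := by
    have e3 := dotProduct_sq_le (hpos h) w h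
    have e4 := quadForm_le (h1 h) h
    have e5 : (r ^ 2 / 2) ^ 2 ≤ (w ⬝ᵥ h) ^ 2 := by gcongr
    have e6 : (d : ℝ) ^ 2 * (C₁ * u ^ κ) * r ^ 2 ≤ n * u ^ κ * r ^ 2 := by
      rw [← mul_assoc, hn]
      gcongr
      linarith
    have e7 := (e5.trans e3).trans (mul_le_mul_of_nonneg_left (e4.trans e6) hq0)
    have hr2 : 0 < r ^ 2 := by positivity
    by_contra! hlt
    nlinarith
  have hus : u ^ (2 - κ) = u ^ 2 / u ^ κ := by
    rw [Real.rpow_sub hu0, Real.rpow_two]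
  have e3 : θ ^ 2 / (4 * n) * u ^ (2 - κ) ≤ q := by
    have hk : 0 < u ^ κ := by positivity
    rw [hus, div_mul_div_comm, div_le_iff₀ (by positivity)]
    have e5 : (θ * u) ^ 2 ≤ r ^ 2 := by gcongr
    nlinarith
  have hU : 0 ≤ u ^ (2 - κ) := by positivity
  have e4 : t * c h ≤ C₂ * u ^ (2 - κ) := by
    calc t * c h ≤ t * (C₂ * u ^ (2 - κ)) := by gcongr; exact h3 h
      _ ≤ C₂ * u ^ (2 - κ) := mul_le_of_le_one_left (by positivity) ht.2
  have e5 : θ ^ 2 / (32 * n) / t * 2 * u ^ (2 - κ) ≤ q / (4 * t) := by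
    rw [le_div_iff₀ (by positivity)]
    refine le_trans (le_of_eq ?_) e3
    field_simp
    norm_num
  have e6 : 2 * C₂ * u ^ (2 - κ) ≤ θ ^ 2 / (32 * n) / t * u ^ (2 - κ) := by
    gcongr
    rw [le_div_iff₀ ht0, mul_comm]
    exact ht2
  rw [kernelExponent]
  have := h2 h
  nlinarith

section Concrete

variable (D : Coord d → Matrix (Fin d) (Fin d) ℝ) (F : Coord d → Coord d) (Φ : Coord d → ℝ)
  (α : ℝ) (x₀ : Coord d)

/-- The diffusion matrix at the interpolation point, as a function of the displacement. -/
def interpDiff (h : Coord d) : Matrix (Fin d) (Fin d) ℝ := D (x₀ + α • h)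

/-- The drift `F - 2 α div D` at the interpolation point, as a function of the displacement. -/
def interpDrift (i : Fin d) (h : Coord d) : ℝ :=
  F (x₀ + α • h) i - 2 * α * divD D (x₀ + α • h) i

/-- The potential `-α div F + α² ∂∂D - Φ` at the interpolation point, as a function of the
displacement. -/
def interpPot (h : Coord d) : ℝ :=
  -α * divF F (x₀ + α • h) + α ^ 2 * ddivD D (x₀ + α • h) - Φ (x₀ + α • h)

variable {D F Φ α x₀}

theorem kernel_add_eq (hpos : ∀ x, (D x).PosDef) {t : ℝ} (ht : 0 < t) (h : Coord d) :
    kernel D F Φ α x₀ t (x₀ + h) = 1 / Real.sqrt ((4 * Real.pi * t) ^ d) *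
      Real.exp (kernelExponent (interpDiff D α x₀) (interpDrift D F α x₀) (interpPot D F Φ α x₀)
        t h) := by
  have h1 : interp α x₀ (x₀ + h) = x₀ + α • h := by rw [interp, add_sub_cancel_left]
  have hdet : 0 < (D (x₀ + α • h)).det := (hpos _).det_pos
  have h2 : 1 / Real.sqrt ((4 * Real.pi * t) ^ d * (D (x₀ + α • h)).det) =
      1 / Real.sqrt ((4 * Real.pi * t) ^ d) * Real.exp (halfLogDet (interpDiff D α x₀) h) := by
    rw [Real.sqrt_mul (by positivity), halfLogDet, interpDiff, neg_div, Real.exp_neg,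
      Real.exp_half, Real.exp_log hdet]
    simp only [one_div, mul_inv]
  have h3 : ∑ i, ∑ j, shift D F α x₀ t (x₀ + h) i * ((D (x₀ + α • h))⁻¹ i j / (4 * t)) *
      shift D F α x₀ t (x₀ + h) j = quadForm (interpDiff D α x₀ h)⁻¹
        (fun i => h i - t * interpDrift D F α x₀ i h) / (4 * t) := by
    have h4 : ∀ i, shift D F α x₀ t (x₀ + h) i = h i - t * interpDrift D F α x₀ i h := by
      intro i
      rw [shift, h1, interpDrift, PiLp.add_apply]
      ring
    simp only [h4, quadForm, interpDiff, Finset.sum_div]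
    exact Finset.sum_congr rfl fun i _ => Finset.sum_congr rfl fun j _ => by ring
  rw [kernel, h1, h2, h3, mul_assoc, ← Real.exp_add, kernelExponent, interpPot]
  congr 2
  ring

theorem gaussianKernel_eq_kernel : gaussianKernel D F Φ x₀ = kernel D F Φ 0 x₀ := by
  ext t x
  simp [gaussianKernel, kernel, shift, interp]

theorem momentIntegrand_add_eq (hpos : ∀ x, (D x).PosDef) {t : ℝ} (ht : 0 < t) {m : ℕ}
    (i : Fin m → Fin d) (h : Coord d) :
    momentIntegrand (kernel D F Φ α x₀ t) x₀ i (x₀ + h) =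
      1 / Real.sqrt ((4 * Real.pi * t) ^ d) * ((∏ k, h (i k)) * Real.exp (kernelExponent
        (interpDiff D α x₀) (interpDrift D F α x₀) (interpPot D F Φ α x₀) t h)) := by
  rw [momentIntegrand, kernel_add_eq hpos ht, mul_left_comm]
  simp

theorem moment_kernel_eq (hpos : ∀ x, (D x).PosDef) {t : ℝ} (ht : 0 < t) {m : ℕ}
    (i : Fin m → Fin d) : moment (kernel D F Φ α x₀ t) x₀ i =
      localMoment (interpDiff D α x₀) (interpDrift D F α x₀) (interpPot D F Φ α x₀) i t := by
  rw [moment, ← integral_add_left_eq_self _ x₀, localMoment, ← integral_const_mul]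
  simp only [momentIntegrand_add_eq hpos ht]

theorem contDiff_interp {n : WithTop ℕ∞} {f : Coord d → ℝ} (hf : ContDiff ℝ n f) (α : ℝ)
    (x₀ : Coord d) : ContDiff ℝ n fun h => f (x₀ + α • h) :=
  hf.comp (contDiff_const.add (contDiff_id.const_smul α))

theorem pd_interp {f : Coord d → ℝ} (hf : Differentiable ℝ f) (α : ℝ) (x₀ : Coord d) (k : Fin d)
    (h : Coord d) : pd k (fun h => f (x₀ + α • h)) h = α * pd k f (x₀ + α • h) := by
  have h1 : HasFDerivAt (fun h : Coord d => x₀ + α • h)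
      (α • ContinuousLinearMap.id ℝ (Coord d)) h :=
    ((hasFDerivAt_id h).const_smul α).const_add x₀
  have h2 : HasFDerivAt (fun h : Coord d => f (x₀ + α • h)) _ h :=
    (hf (x₀ + α • h)).hasFDerivAt.comp h h1
  rw [pd, h2.fderiv, pd]
  simp

theorem contDiff_pd {f : Coord d → ℝ} (hf : ContDiff ℝ 2 f) (k : Fin d) : ContDiff ℝ 1 (pd k f) :=
  (hf.fderiv_right (by norm_num)).clm_apply contDiff_const

theorem contDiff_divD (hD : ∀ i j, ContDiff ℝ 2 fun x => D x i j) (i : Fin d) :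
    ContDiff ℝ 1 fun x => divD D x i :=
  ContDiff.sum fun k _ => contDiff_pd (hD i k) k

theorem contDiff_comp_coord (hF : ContDiff ℝ 1 F) (i : Fin d) : ContDiff ℝ 1 fun x => F x i :=
  (EuclideanSpace.proj i : Coord d →L[ℝ] ℝ).contDiff.comp hF

theorem continuous_pd {f : Coord d → ℝ} (hf : ContDiff ℝ 1 f) (k : Fin d) : Continuous (pd k f) :=
  (hf.continuous_fderiv one_ne_zero).clm_apply continuous_const

theorem contDiff_interpDrift (hD : ∀ i j, ContDiff ℝ 2 fun x => D x i j) (hF : ContDiff ℝ 1 F)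
    (i : Fin d) : ContDiff ℝ 1 (interpDrift D F α x₀ i) :=
  (contDiff_interp (contDiff_comp_coord hF i) α x₀).sub
    (contDiff_const.mul (contDiff_interp (contDiff_divD hD i) α x₀))

theorem continuous_interpPot (hD : ∀ i j, ContDiff ℝ 2 fun x => D x i j) (hF : ContDiff ℝ 1 F)
    (hΦ : Continuous Φ) : Continuous (interpPot D F Φ α x₀) := by
  have h1 : Continuous (divF F) :=
    continuous_finsetSum _ fun i _ => continuous_pd (contDiff_comp_coord hF i) i
  have h2 : Continuous (ddivD D) := continuous_finsetSum _ fun i _ =>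
    continuous_finsetSum _ fun j _ => continuous_pd (contDiff_pd (hD i j) j) i
  unfold interpPot
  fun_prop

theorem divD_interpDiff (hD : ∀ i j, ContDiff ℝ 2 fun x => D x i j) (h : Coord d) (i : Fin d) :
    divD (interpDiff D α x₀) h i = α * divD D (x₀ + α • h) i := by
  rw [divD, divD, Finset.mul_sum]
  exact Finset.sum_congr rfl fun k _ =>
    pd_interp ((hD i k).differentiable two_ne_zero) α x₀ k h

theorem ddivD_interpDiff (hD : ∀ i j, ContDiff ℝ 2 fun x => D x i j) (h : Coord d) :
    ddivD (interpDiff D α x₀) h = α ^ 2 * ddivD D (x₀ + α • h) := by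
  rw [ddivD, ddivD, Finset.mul_sum]
  refine Finset.sum_congr rfl fun i _ => ?_
  rw [Finset.mul_sum]
  refine Finset.sum_congr rfl fun j _ => ?_
  have h1 : (pd j fun y => interpDiff D α x₀ y i j) =
      fun h => α * pd j (fun x => D x i j) (x₀ + α • h) :=
    funext fun h => pd_interp ((hD i j).differentiable two_ne_zero) α x₀ j h
  have hd : Differentiable ℝ (pd j fun x => D x i j) :=
    (contDiff_pd (hD i j) j).differentiable one_ne_zero
  have h2 : pd i (fun h => α * pd j (fun x => D x i j) (x₀ + α • h)) h =
      α * (α * pd i (pd j fun x => D x i j) (x₀ + α • h)) := by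
    rw [← pd_interp hd]
    rw [pd, pd, fderiv_const_mul ((contDiff_interp (contDiff_pd (hD i j) j) α x₀).differentiable
      one_ne_zero h), smul_apply, smul_eq_mul]
  rw [h1, h2]
  ring

theorem sum_pd_interpDrift (hD : ∀ i j, ContDiff ℝ 2 fun x => D x i j) (hF : ContDiff ℝ 1 F)
    (h : Coord d) : ∑ i, pd i (interpDrift D F α x₀ i) h =
      α * divF F (x₀ + α • h) - 2 * α ^ 2 * ddivD D (x₀ + α • h) := by
  have hp : ∀ i k, Differentiable ℝ (pd k fun x => D x i k) := fun i k =>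
    (contDiff_pd (hD i k) k).differentiable one_ne_zero
  have h0 : ∀ i x, pd i (fun x => divD D x i) x = ∑ k, pd i (pd k fun x => D x i k) x := by
    intro i x
    unfold divD
    rw [pd, fderiv_fun_sum fun k _ => hp i k x, sum_apply]
    rfl
  have h1 : ∀ i, pd i (interpDrift D F α x₀ i) h = α * pd i (fun x => F x i) (x₀ + α • h)
      - 2 * α ^ 2 * ∑ k, pd i (pd k fun x => D x i k) (x₀ + α • h) := by
    intro i
    have hFi := contDiff_comp_coord hF i
    have hDi := contDiff_divD hD i
    have h2 : HasFDerivAt (interpDrift D F α x₀ i) _ h :=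
      ((contDiff_interp hFi α x₀).differentiable one_ne_zero h).hasFDerivAt.sub
      (((contDiff_interp hDi α x₀).differentiable one_ne_zero h).hasFDerivAt.const_mul (2 * α))
    have h3 := pd_interp (hFi.differentiable one_ne_zero) α x₀ i h
    have h4 := pd_interp (hDi.differentiable one_ne_zero) α x₀ i h
    rw [h0] at h4
    rw [pd, h2.fderiv, sub_apply, smul_apply, smul_eq_mul, ← h3]
    rw [pd] at h4 ⊢
    rw [h4]
    ring
  simp only [h1, Finset.sum_sub_distrib, ← Finset.mul_sum]
  rfl

theorem hasTailBound_interp (hpos : ∀ x, (D x).PosDef) {κ C : ℝ} (hκ₀ : 0 ≤ κ) (hκ₂ : κ < 2)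
    (hD_growth : ∀ y i j, |D y i j| ≤ C * (1 + ‖y‖) ^ κ)
    (hD_det : ∀ y, -Real.log (D y).det ≤ C * (1 + ‖y‖) ^ (2 - κ))
    (hD_div : ∀ y, -∑ i, (y i - x₀ i) * divD D y i ≤ C * (1 + ‖y‖) ^ 2)
    (hD_ddiv : ∀ y, ddivD D y ≤ C * (1 + ‖y‖) ^ (2 - κ))
    (hF_growth : ∀ y, ∑ i, (y i - x₀ i) * F y i ≤ C * (1 + ‖y‖) ^ 2)
    (hF_div : ∀ y, -divF F y ≤ C * (1 + ‖y‖) ^ (2 - κ))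
    (hΦ_growth : ∀ y, -Φ y ≤ C * (1 + ‖y‖) ^ (2 - κ)) (hα : α ∈ Set.Icc (0 : ℝ) 1) :
    HasTailBound (interpDiff D α x₀) (interpDrift D F α x₀) (interpPot D F Φ α x₀) := by
  set X := 1 + ‖x₀‖ with hX
  have hX0 : 0 ≤ X := by positivity
  have hy : ∀ h : Coord d, 1 + ‖x₀ + α • h‖ ≤ X * (1 + ‖h‖) := by
    intro h
    have h1 : ‖x₀ + α • h‖ ≤ ‖x₀‖ + ‖h‖ := by
      refine (norm_add_le _ _).trans ?_
      gcongr
      rw [norm_smul, Real.norm_of_nonneg hα.1]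
      exact mul_le_of_le_one_left (norm_nonneg _) hα.2
    have h2 : 0 ≤ ‖x₀‖ * ‖h‖ := by positivity
    rw [hX]
    linarith
  have hrpow : ∀ (p : ℝ), 0 ≤ p → ∀ h : Coord d,
      C * (1 + ‖x₀ + α • h‖) ^ p ≤ |C| * X ^ p * (1 + ‖h‖) ^ p := by
    intro p hp h
    rw [mul_assoc, ← Real.mul_rpow hX0 (by positivity)]
    exact mul_le_mul (le_abs_self C) (Real.rpow_le_rpow (by positivity) (hy h) hp) (by positivity)
      (abs_nonneg C)
  have hsq : ∀ h : Coord d, C * (1 + ‖x₀ + α • h‖) ^ 2 ≤ |C| * X ^ 2 * (1 + ‖h‖) ^ 2 := by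
    intro h
    rw [mul_assoc, ← mul_pow]
    exact mul_le_mul (le_abs_self C) (pow_le_pow_left₀ (by positivity) (hy h) 2) (by positivity)
      (abs_nonneg C)
  have hκ' : 0 ≤ 2 - κ := by linarith
  set C₂ := |C| * X ^ (2 - κ) with hC₂
  have hC₂0 : 0 ≤ C₂ := by positivity
  have hB : ∃ B : ℝ, ∀ h : Coord d, ∑ i, h i * interpDrift D F α x₀ i h ≤ B * (1 + ‖h‖) ^ 2 := by
    rcases hα.1.eq_or_lt with h0 | h0
    · -- for `α = 0` the drift is constant
      refine ⟨∑ i, |F x₀ i|, fun h => ?_⟩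
      rw [Finset.sum_mul]
      refine Finset.sum_le_sum fun i _ => ?_
      have h1 : interpDrift D F α x₀ i h = F x₀ i := by simp [interpDrift, ← h0]
      rw [h1]
      calc h i * F x₀ i ≤ |h i| * |F x₀ i| := by rw [← abs_mul]; exact le_abs_self _
        _ ≤ (1 + ‖h‖) ^ 2 * |F x₀ i| := by
          gcongr
          nlinarith [abs_apply_le_norm h i, norm_nonneg h]
        _ = _ := mul_comm _ _
    · -- for `α > 0` the displacement is a multiple of `y - x₀`
      refine ⟨(1 / α + 2) * (|C| * X ^ 2), fun h => ?_⟩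
      have h1 := (hF_growth (x₀ + α • h)).trans (hsq h)
      have h2 := (hD_div (x₀ + α • h)).trans (hsq h)
      have h3 : ∑ i, h i * interpDrift D F α x₀ i h =
          (1 / α) * ∑ i, ((x₀ + α • h) i - x₀ i) * F (x₀ + α • h) i +
            2 * -∑ i, ((x₀ + α • h) i - x₀ i) * divD D (x₀ + α • h) i := by
        rw [mul_neg, ← sub_eq_add_neg, Finset.mul_sum, Finset.mul_sum, ← Finset.sum_sub_distrib]
        refine Finset.sum_congr rfl fun i _ => ?_
        simp only [PiLp.add_apply, PiLp.smul_apply, smul_eq_mul, interpDrift]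
        field_simp
        ring
      have h4 := mul_le_mul_of_nonneg_left h1 (by positivity : 0 ≤ 1 / α)
      rw [h3]
      linarith
  obtain ⟨B, hB⟩ := hB
  refine hasTailBound_of_growth (κ := κ) (C₁ := |C| * X ^ κ) (C₂ := 3 * C₂) (B := B)
    (fun y => hpos _) hκ₂ (by positivity) (by positivity)
    (fun h i j => (hD_growth _ i j).trans (hrpow κ hκ₀ h)) (fun h => ?_) (fun h => ?_) hB
  · have h1 := (hD_det (x₀ + α • h)).trans (hrpow _ hκ' h)
    have h2 : 0 ≤ C₂ * (1 + ‖h‖) ^ (2 - κ) := by positivity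
    rw [halfLogDet, interpDiff]
    linarith
  · have h1 := (hD_ddiv (x₀ + α • h)).trans (hrpow _ hκ' h)
    have h2 := (hF_div (x₀ + α • h)).trans (hrpow _ hκ' h)
    have h3 := (hΦ_growth (x₀ + α • h)).trans (hrpow _ hκ' h)
    have h4 : 0 ≤ C₂ * (1 + ‖h‖) ^ (2 - κ) := by positivity
    have h5 : α * -divF F (x₀ + α • h) ≤ C₂ * (1 + ‖h‖) ^ (2 - κ) :=
      (mul_le_mul_of_nonneg_left h2 hα.1).trans (mul_le_of_le_one_left h4 hα.2)
    have h6 : α ^ 2 * ddivD D (x₀ + α • h) ≤ C₂ * (1 + ‖h‖) ^ (2 - κ) :=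
      (mul_le_mul_of_nonneg_left h1 (sq_nonneg α)).trans
        (mul_le_of_le_one_left h4 (pow_le_one₀ hα.1 hα.2))
    rw [interpPot]
    linarith

theorem eventually_hasMoments (hD : ∀ i j, ContDiff ℝ 2 fun x => D x i j) (hF : ContDiff ℝ 1 F)
    (hΦ : Continuous Φ) (hpos : ∀ x, (D x).PosDef)
    (ht : HasTailBound (interpDiff D α x₀) (interpDrift D F α x₀) (interpPot D F Φ α x₀)) :
    ∀ᶠ t in 𝓝[>] (0 : ℝ), HasMoments (kernel D F Φ α x₀ t) x₀ := by
  filter_upwards [eventually_integrable (fun i j => contDiff_interp (hD i j) α x₀)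
    (fun y => hpos _) (fun i => (contDiff_interpDrift hD hF i).continuous)
    (continuous_interpPot hD hF hΦ) ht, self_mem_nhdsWithin] with t h (ht : 0 < t) m i
  have h1 : Integrable fun h => momentIntegrand (kernel D F Φ α x₀ t) x₀ i (x₀ + h) := by
    simp only [momentIntegrand_add_eq hpos ht]
    have := h (monom i)
    simp only [evalAt_monom] at this
    exact this.const_mul _
  simpa using h1.comp_add_left (-x₀)

theorem equivalent_kernel (hD : ∀ i j, ContDiff ℝ 2 fun x => D x i j) (hF : ContDiff ℝ 1 F)
    (hΦ : Continuous Φ) (hpos : ∀ x, (D x).PosDef) {β : ℝ}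
    (hα : HasTailBound (interpDiff D α x₀) (interpDrift D F α x₀) (interpPot D F Φ α x₀))
    (hβ : HasTailBound (interpDiff D β x₀) (interpDrift D F β x₀) (interpPot D F Φ β x₀)) :
    Equivalent x₀ (kernel D F Φ α x₀) (kernel D F Φ β x₀) := by
  refine ⟨(eventually_hasMoments hD hF hΦ hpos hα).and (eventually_hasMoments hD hF hΦ hpos hβ),
    fun m i => ?_⟩
  -- the effective drift is `F x₀` and the effective potential `-Φ x₀`, whatever `α` is
  have drift : ∀ (γ : ℝ) (i : Fin d),
      2 * divD (interpDiff D γ x₀) 0 i + interpDrift D F γ x₀ i 0 = F x₀ i := by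
    intro γ i
    rw [divD_interpDiff hD, interpDrift, smul_zero, add_zero]
    ring
  have pot : ∀ γ : ℝ, ddivD (interpDiff D γ x₀) 0 + ∑ i, pd i (interpDrift D F γ x₀ i) 0
      + interpPot D F Φ γ x₀ 0 = -Φ x₀ := by
    intro γ
    rw [ddivD_interpDiff hD, sum_pd_interpDrift hD hF, interpPot, smul_zero, add_zero]
    ring
  have key := isLittleO_localMoment_sub (M := interpDiff D α x₀)
    (M' := interpDiff D β x₀) (fun i j => contDiff_interp (hD i j) α x₀)
    (fun y => hpos _) (contDiff_interpDrift hD hF) (continuous_interpPot hD hF hΦ) hα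
    (fun i j => contDiff_interp (hD i j) β x₀) (fun y => hpos _) (contDiff_interpDrift hD hF)
    (continuous_interpPot hD hF hΦ) hβ (by simp [interpDiff]) (fun i => by rw [drift, drift])
    (by rw [pot, pot]) i
  refine key.congr' ?_ EventuallyEq.rfl
  filter_upwards [self_mem_nhdsWithin] with t (ht : 0 < t)
  rw [moment_kernel_eq hpos ht, moment_kernel_eq hpos ht]

end Concrete

end
end TimeSlice

theorem lemma3 (d : ℕ)
    (D : TimeSlice.Coord d → Matrix (Fin d) (Fin d) ℝ)
    (F : TimeSlice.Coord d → TimeSlice.Coord d)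
    (Φ : TimeSlice.Coord d → ℝ)
    (hD : ∀ i j, ContDiff ℝ 2 (fun x => D x i j))
    (hF : ContDiff ℝ 1 F)
    (hΦ : Continuous Φ)
    (hpos : ∀ x, (D x).PosDef)
    (x₀ : TimeSlice.Coord d)
    -- growth at infinity, so that the kernels have moments and do not put mass far from `x₀`
    (κ C : ℝ) (hκ₀ : 0 ≤ κ) (hκ₂ : κ < 2)
    (hD_growth : ∀ y i j, |D y i j| ≤ C * (1 + ‖y‖) ^ κ)
    (hD_det : ∀ y, -Real.log (D y).det ≤ C * (1 + ‖y‖) ^ (2 - κ))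
    (hD_div : ∀ y, -∑ i, (y i - x₀ i) * TimeSlice.divD D y i ≤ C * (1 + ‖y‖) ^ 2)
    (hD_ddiv : ∀ y, TimeSlice.ddivD D y ≤ C * (1 + ‖y‖) ^ (2 - κ))
    (hF_growth : ∀ y, ∑ i, (y i - x₀ i) * F y i ≤ C * (1 + ‖y‖) ^ 2)
    (hF_div : ∀ y, -TimeSlice.divF F y ≤ C * (1 + ‖y‖) ^ (2 - κ))
    (hΦ_growth : ∀ y, -Φ y ≤ C * (1 + ‖y‖) ^ (2 - κ)) :
    (∀ α ∈ Set.Icc (0 : ℝ) 1, ∀ β ∈ Set.Icc (0 : ℝ) 1,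
      TimeSlice.Equivalent x₀ (TimeSlice.kernel D F Φ α x₀) (TimeSlice.kernel D F Φ β x₀)) ∧
    (∀ α ∈ Set.Icc (0 : ℝ) 1,
      TimeSlice.Equivalent x₀ (TimeSlice.kernel D F Φ α x₀)
        (TimeSlice.gaussianKernel D F Φ x₀)) := by
  have htail : ∀ α ∈ Set.Icc (0 : ℝ) 1, TimeSlice.HasTailBound (TimeSlice.interpDiff D α x₀)
      (TimeSlice.interpDrift D F α x₀) (TimeSlice.interpPot D F Φ α x₀) := fun α hα =>
    TimeSlice.hasTailBound_interp hpos hκ₀ hκ₂ hD_growth hD_det hD_div hD_ddiv hF_growth hF_div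
      hΦ_growth hα
  refine ⟨fun α hα β hβ => TimeSlice.equivalent_kernel hD hF hΦ hpos (htail α hα) (htail β hβ),
    fun α hα => ?_⟩
  rw [TimeSlice.gaussianKernel_eq_kernel]
  exact TimeSlice.equivalent_kernel hD hF hΦ hpos (htail α hα)
    (htail 0 (Set.left_mem_Icc.2 zero_le_one))
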